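/- **Setting.** Let $d\ge 1$, let $P$ be the uniform distribution on the closed unit ball $\mathcal X\subset\mathbb R^d$, and let $f^*:\mathbb R^d\to\{-1,0,1\}$ be a measurable true labeling (for instance, in the realizable case, $f^*(\mathbf x)=\operatorname{sign}\langle \mathbf w^*,\mathbf x\rangle$). Hypotheses are $h_{\mathbf w}(\mathbf x)=\operatorname{sign}\langle\mathbf w,\mathbf x\rangle$ with $\|\mathbf w\|_2=1$, the confidence is $g(\mathbf w,\mathbf x)=|\langle\mathbf w,\mathbf x\rangle|$, with threshold set $T=[0,1]$; the threshold $\infty$ means "abstain everywhere". The pair $(\mathbf w,t)$ labels $\mathbf x$ by $h_{\mathbf w}(\mathbf x)$ if $g(\mathbf w,\mathbf x)\ge t$ and abstains otherwise. Let $X_{pool}=(\mathbf x_1,\dots,\mathbf x_N)$, $N\ge d$, and a validation sample $X_v$ be jointly i.i.d. from $P$. **Algorithm.** Threshold-based auto-labeling is run for $k\ge1$ rounds, with parameters $\epsilon_a\in\mathbb R$, $n_s,n_b\ge0$, $n_0\ge1$ and a real-valued confidence term $\hat\sigma$. Write $$\mathcal X^{(i)}=\{\mathbf x\in\mathcal X: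 g(\hat{\mathbf w}_j,\mathbf x)<\hat t_j\ \forall j<i\},$$ and let $X^{(i)}$ and $X_v^{(i)}$ be the points of $X_{pool}$ and of $X_v$ satisfying the same condition ($g(\hat{\mathbf w}_j,\cdot)<\hat t_j$ for all $j<i$). Before round $1$ a seed batch of $\min(n_s,N)$ pool points is queried for its true labels. In round $i$, $\hat{\mathbf w}_i$ is an empirical 0-1 risk minimizer over unit vectors on all pool points queried so far. The threshold $\hat t_i$ is the least element of the set consisting of $\infty$ and of all scores $t=g(\hat{\mathbf w}_i,\mathbf x)$, $\mathbf x\in X^{(i)}$ not queried so far, for which at least $n_0$ points of $X_v^{(i)}$ have score $\ge t$ and $\widehat{\mathcal E}_a(\hat{\mathbf w}_i,t|X_v^{(i)})+\hat\sigma(\hat{\mathbf w}_i,t,X_v^{(i)})\le\epsilon_a$. Here $\widehat{\mathcal E}_a(\mathbf w,t|S)$ is the fraction of points misclassified by $h_{\mathbf w}$ among the points of $S$ on which $(\mathbf w,t)$ does not abstain. For the next round, a batch of $n_b$ points (or all, if fewer are left) is queried among the not yet queried points of $X^{(i+1)}$. The rules choosing the batches and breaking ties between minimizers are arbitrary and may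 be random. The points auto-labeled in round $i$ are the points of $X^{(i)}$ with $g(\hat{\mathbf w}_i,\cdot)\ge\hat t_i$; they receive the label $h_{\hat{\mathbf w}_i}$. (Queried points are used for training but are not taken out of $X^{(i)}$ in this count.) Let $n_v^{(i)}=|X_v^{(i)}|$, let $n_a^{(i)}$ be the number of points auto-labeled in round $i$, $N_a^{(k)}=\sum_{i=1}^k n_a^{(i)}$, let $\widehat{\mathcal E}(X_{pool}(A_k))$ be the fraction of wrong labels among the auto-labeled points and $\widehat{\mathcal P}(X_{pool}(A_k))=N_a^{(k)}/N$ the coverage. Let $\delta,p_0\in(0,1)$. **Corollary.** (1) With probability at least $1-\delta/2$ the following holds: if $P\big(g(\hat{\mathbf w}_i,\mathbf x)\ge\hat t_i\,\big|\,\mathbf x\in\mathcal X^{(i)}\big)\ge p_0$ and $n_v^{(i)}\ge d$ for all $i\le k$, and $N_a^{(k)}\ge d$, then $$\widehat{\mathcal E}(X_{pool}(A_k))\le\sum_{i=1}^k\frac{n_a^{(i)}}{N_a^{(k)}}\left(\widehat{\mathcal E}_a(\hat{\mathbf w}_i,\hat t_i|X_v^{(i)})+\frac4{p_0}\sqrt{\frac2{n_v^{(i)}}\Big(2d\log\frac{e\,n_v^{(i)}}d+\log\frac{8k}\delta\Big)}\right)+\frac4{p_0}\sqrt{\frac{2k}{N_a^{(k)}}\Big(2d\log\frac{e\,N_a^{(k)}}d+\log\frac{8k}\delta\Big)}.$$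 (2) With probability at least $1-\delta/2$, $$\widehat{\mathcal P}(X_{pool}(A_k))\ge1-\min_{i\le k}\hat t_i\,\sqrt{4d/\pi}-2k\sqrt{\frac2N\Big(2d\log\frac{eN}d+\log\frac{8k}\delta\Big)}$$ (which is void if $\hat t_i=\infty$ for all $i$). -/

import Mathlib

open MeasureTheory ProbabilityTheory

namespace AutoLabel

/-- The ambient space `ℝ^d` with its Euclidean norm. -/
abbrev E (d : ℕ) : Type := EuclideanSpace ℝ (Fin d)

/-- The homogeneous linear classifier `h_w(x) = sign ⟨w, x⟩`. -/
noncomputable def linClassifier {d : ℕ} (w x : E d) : SignType := SignType.sign (inner ℝ w x)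

/-- The margin confidence `g(w, x) = |⟨w, x⟩|`. -/
noncomputable def margin {d : ℕ} (w x : E d) : ℝ := |inner ℝ w x|

/-- `(w, t)` does not abstain on `x`, that is `g(w, x) ≥ t`. The threshold `t = ∞` (abstain
everywhere) is allowed, so thresholds are extended reals. -/
def Accepts {d : ℕ} (w : E d) (t : EReal) (x : E d) : Prop := t ≤ ((margin w x : ℝ) : EReal)

/-- The uniform distribution on the closed unit ball of `ℝ^d`. -/
noncomputable def unifBall (d : ℕ) : Measure (E d) :=
  ProbabilityTheory.cond (volume : Measure (E d)) (Metric.closedBall 0 1)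

/-- The region of the unit ball left unlabeled at the beginning of round `i`
(rounds are numbered from `0`). -/
def region {d : ℕ} (w : ℕ → E d) (t : ℕ → EReal) (i : ℕ) : Set (E d) :=
  {x | x ∈ Metric.closedBall (0 : E d) 1 ∧ ∀ l < i, ¬ Accepts (w l) (t l) x}

/-- The conditional probability `P(w, t | S)` that `(w, t)` does not abstain, given `S`. -/
noncomputable def acceptProb {d : ℕ} (w : E d) (t : EReal) (S : Set (E d)) : ℝ :=
  (ProbabilityTheory.cond (unifBall d) S).real {x | x ∈ S ∧ Accepts w t x}

open scoped Classical in
/-- The indices of the points of the sample `z` that are left at the beginning of round `i`.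
For the pool this is `X^(i)`, for the validation sample it is `X_v^(i)`. -/
noncomputable def remaining {d n : ℕ} (z : Fin n → E d) (w : ℕ → E d) (t : ℕ → EReal) (i : ℕ) :
    Finset (Fin n) :=
  Finset.univ.filter fun m => ∀ l < i, ¬ Accepts (w l) (t l) (z m)

open scoped Classical in
/-- `S(w, t)`: the indices in `S` of the points on which `(w, t)` does not abstain. -/
noncomputable def accepted {d n : ℕ} (z : Fin n → E d) (S : Finset (Fin n)) (w : E d) (t : EReal) :
    Finset (Fin n) :=
  S.filter fun m => Accepts w t (z m)

open scoped Classical in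
/-- The 0-1 loss of `h_w` at `x`, for the true labeling `f`. -/
noncomputable def loss01 {d : ℕ} (f : E d → SignType) (w x : E d) : ℝ :=
  if linClassifier w x ≠ f x then 1 else 0

/-- The empirical conditional error of `(w, t)` on the part of the sample `S` where `(w, t)`
does not abstain. -/
noncomputable def empCondErr {d n : ℕ} (f : E d → SignType) (z : Fin n → E d) (S : Finset (Fin n))
    (w : E d) (t : EReal) : ℝ :=
  (∑ m ∈ accepted z S w t, loss01 f w (z m)) / ((accepted z S w t).card : ℝ)

/-- `w` minimizes the empirical 0-1 loss on the training points `D` over all unit vectors. -/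
def IsERM {d n : ℕ} (f : E d → SignType) (z : Fin n → E d) (D : Finset (Fin n)) (w : E d) : Prop :=
  ‖w‖ = 1 ∧ ∀ u : E d, ‖u‖ = 1 → ∑ m ∈ D, loss01 f w (z m) ≤ ∑ m ∈ D, loss01 f u (z m)

/-- The inputs of the algorithm other than the data: error tolerance `εa`, seed size `ns`,
query batch size `nb`, minimal number `n₀` of validation points above a usable threshold, and the
confidence term `σ w t V` added to the validation error (`V` is the labeled validation data). -/
structure Params (d : ℕ) where
  εa : ℝ
  ns : ℕ
  nb : ℕ
  n₀ : ℕ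
  σ : E d → ℝ → Multiset (E d × SignType) → ℝ

/-- The thresholds among which a round chooses: the scores of the points of `Xu` that have at
least `n₀` validation points above them and whose validation error plus confidence term is at most
`εa`, and `∞`. -/
def admissibleThresholds {d N M : ℕ} (par : Params d) (f : E d → SignType)
    (x : Fin N → E d) (Xu : Finset (Fin N)) (v : Fin M → E d) (Xv : Finset (Fin M)) (w : E d) :
    Set EReal :=
  {t | t = ⊤ ∨ ∃ m ∈ Xu, t = ((margin w (x m) : ℝ) : EReal) ∧
    par.n₀ ≤ (accepted v Xv w t).card ∧
    empCondErr f v Xv w t + par.σ w (margin w (x m)) (Xv.val.map fun j => (v j, f (v j)))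
      ≤ par.εa}

/-- The points queried in the rounds `0, …, i`; these are the training points of round `i`. -/
def trainSet {N : ℕ} (Q : ℕ → Finset (Fin N)) (i : ℕ) : Finset (Fin N) :=
  (Finset.range (i + 1)).biUnion Q

/-- `k` rounds of threshold-based auto-labeling on the pool `x` and the validation sample `v`, with
true labeling `f`. `Q i` is the batch queried for round `i`, `w i` the classifier and `t i` the
threshold of round `i`. Any rule may be used to choose the batches and to break ties between
empirical risk minimizers. A round in which no unqueried, unlabeled pool point is left is idle:
its threshold is `∞`. -/
structure IsTBALRun {d N M : ℕ} (par : Params d) (f : E d → SignType)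
    (x : Fin N → E d) (v : Fin M → E d) (k : ℕ)
    (Q : ℕ → Finset (Fin N)) (w : ℕ → E d) (t : ℕ → EReal) : Prop where
  seed_card : (Q 0).card = min par.ns N
  query_subset : ∀ i, i + 1 < k → Q (i + 1) ⊆ remaining x w t (i + 1) \ trainSet Q i
  query_card : ∀ i, i + 1 < k →
    (Q (i + 1)).card = min par.nb (remaining x w t (i + 1) \ trainSet Q i).card
  erm : ∀ i < k, IsERM f x (trainSet Q i) (w i)
  threshold : ∀ i < k,
    IsLeast (admissibleThresholds par f x (remaining x w t i \ trainSet Q i) v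
      (remaining v w t i) (w i)) (t i)

/-- `X^(i)(w_i, t_i)`: the pool points auto-labeled in round `i`. Here `X^(i)` is the set of pool
points on which all earlier rounds abstain; points queried for training are not taken out of it. -/
noncomputable def autoRound {d N : ℕ} (x : Fin N → E d) (w : ℕ → E d) (t : ℕ → EReal) (i : ℕ) :
    Finset (Fin N) :=
  accepted x (remaining x w t i) (w i) (t i)

/-- `A_k`: the pool points auto-labeled in the first `k` rounds. -/
noncomputable def autoLabeled {d N : ℕ} (x : Fin N → E d) (w : ℕ → E d) (t : ℕ → EReal) (k : ℕ) :
    Finset (Fin N) :=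
  (Finset.range k).biUnion (autoRound x w t)

/-- The label assigned to an auto-labeled point `y`: that of the classifier of the first round
which does not abstain on `y`. -/
noncomputable def autoLabel {d : ℕ} (w : ℕ → E d) (t : ℕ → EReal) (y : E d) : SignType :=
  linClassifier (w (sInf {i | Accepts (w i) (t i) y})) y

open scoped Classical in
/-- The auto-labeling error: the fraction of wrong labels among the auto-labeled pool points. -/
noncomputable def autoErr {d N : ℕ} (f : E d → SignType) (x : Fin N → E d)
    (w : ℕ → E d) (t : ℕ → EReal) (k : ℕ) : ℝ :=
  (∑ m ∈ autoLabeled x w t k, if autoLabel w t (x m) ≠ f (x m) then (1 : ℝ) else 0) /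
    ((autoLabeled x w t k).card : ℝ)

/-- The coverage: the fraction of the pool that is auto-labeled. -/
noncomputable def coverage {d N : ℕ} (x : Fin N → E d) (w : ℕ → E d) (t : ℕ → EReal) (k : ℕ) : ℝ :=
  ((autoLabeled x w t k).card : ℝ) / (N : ℝ)

/-- The complexity term `2 d log(e n / d) + log(8 k / δ)`. -/
noncomputable def complexityTerm (d k : ℕ) (δ : ℝ) (n : ℕ) : ℝ :=
  2 * (d : ℝ) * Real.log (Real.exp 1 * (n : ℝ) / (d : ℝ)) + Real.log (8 * (k : ℝ) / δ)

end AutoLabel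

/-!
The classifiers and thresholds depend on the data, so every deviation is bounded uniformly over
all of them: symmetrization replaces the distribution by a ghost sample, and by the Sauer-Shelah
lemma and Radon's theorem the pairs `(w, t)` produce at most `roundGrowth d n` patterns of labels
and abstentions on the doubled sample. After `i` rounds there are at most `roundGrowth d n ^ i`
patterns, so the squared deviations of round `i` grow linearly in `i`. On the validation sample
they are measured relative to the probability of the points labeled in the round. Since every
round labels at least the fraction `p₀` of what is left, that probability decays geometrically,
and the slacks `roundScale` are chosen so that the deviations of all rounds add up to the penalty
of a single one, multiplied by the probability of the labeled region.

For the pool, the error is an average of wrong labels, and comparing it with the validation errors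
`x i ∈ [0, 1]` leads to the combination of wrong labels with weights `1 - x i` and of right labels
with weights `-x i`. It is linear in each `x i`, so its maximum is attained at one of the `2 ^ k`
functions `mixture f k S`.

For the coverage, a point left after `k` rounds lies in a slab `{x | |⟪w, x⟫| < t}` for the smallest
threshold `t`. The slab has probability at most `t * √(4 * d / π)`, by slicing the ball and by
log-convexity of the Gamma function.
-/

namespace AutoLabel

section Growth

variable {Θ Θ' 𝒳 β γ : Type*}

/-- A bound on the growth function (shatter coefficients) of a class of functions: on any `m`
points the functions `φ θ` have at most `Γ` different restrictions. -/
def GrowthLE (φ : Θ → 𝒳 → β) (m Γ : ℕ) : Prop :=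
  ∀ Z : Fin m → 𝒳, (Set.range fun θ j => φ θ (Z j)).encard ≤ Γ

theorem encard_range_le_of_factorsThrough {f : Θ → β} {g : Θ → γ} (h : f.FactorsThrough g) :
    (Set.range f).encard ≤ (Set.range g).encard := by
  cases isEmpty_or_nonempty Θ
  · simp [Set.range_eq_empty]
  have : Nonempty β := .map f ‹_›
  obtain ⟨e, rfl⟩ := (Function.factorsThrough_iff f).1 h
  rw [Set.range_comp]
  exact Set.encard_image_le _ _

theorem GrowthLE.encard_range_le {ι : Type*} [Fintype ι] {φ : Θ → 𝒳 → β} {m Γ : ℕ}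
    (h : GrowthLE φ m Γ) (hm : Fintype.card ι = m) (Z : ι → 𝒳) :
    (Set.range fun θ j => φ θ (Z j)).encard ≤ Γ := by
  subst hm
  have e := Fintype.equivFin ι
  refine (encard_range_le_of_factorsThrough fun θ θ' hθ => ?_).trans (h (Z ∘ e.symm))
  funext j
  simpa using congrFun hθ (e j)

/-- The restriction of `φ θ` to a sample is a function of the `r` restrictions of the
`ψ (g l θ)`. -/
theorem GrowthLE.pow {ψ : Θ → 𝒳 → β} {m Γ r : ℕ} (h : GrowthLE ψ m Γ) (g : Fin r → Θ' → Θ)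
    {φ : Θ' → 𝒳 → γ}
    (hφ : ∀ θ θ' x, (∀ l, ψ (g l θ) x = ψ (g l θ') x) → φ θ x = φ θ' x) :
    GrowthLE φ m (Γ ^ r) := by
  intro Z
  set A := Set.range fun θ j => ψ θ (Z j)
  let pattern : Θ' → Fin r → Fin m → β := fun θ l j => ψ (g l θ) (Z j)
  have hpattern : Set.range pattern ⊆ Set.univ.pi fun _ => A := by
    rintro _ ⟨θ, rfl⟩ l -
    exact ⟨g l θ, rfl⟩
  calc (Set.range fun θ j => φ θ (Z j)).encard
      ≤ (Set.range pattern).encard := encard_range_le_of_factorsThrough fun θ θ' hθ =>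
        funext fun j => hφ θ θ' (Z j) fun l => congrFun (congrFun hθ l) j
    _ ≤ (Set.univ.pi fun _ : Fin r => A).encard := Set.encard_le_encard hpattern
    _ = A.encard ^ r := by simp [Set.encard_pi_eq_prod_encard]
    _ ≤ (Γ ^ r : ℕ) := by
        push_cast
        gcongr
        exact h Z

end Growth

section RandomSwaps

variable {Θ 𝒳 : Type*} [MeasurableSpace 𝒳] {n : ℕ}

/-- The random swaps of symmetrization: exchange the components of the pairs `z j` with
`σ j = true`. -/
def swapPairs (σ : Fin n → Bool) : (Fin n → 𝒳 × 𝒳) ≃ᵐ (Fin n → 𝒳 × 𝒳) :=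
  MeasurableEquiv.piCongrRight fun j =>
    if σ j then MeasurableEquiv.prodComm else MeasurableEquiv.refl _

theorem swapPairs_apply (σ : Fin n → Bool) (z : Fin n → 𝒳 × 𝒳) (j : Fin n) :
    swapPairs σ z j = if σ j then (z j).swap else z j := by
  change (if σ j then MeasurableEquiv.prodComm else MeasurableEquiv.refl _ : 𝒳 × 𝒳 ≃ᵐ 𝒳 × 𝒳) (z j)
    = _
  cases σ j <;> rfl

theorem measurePreserving_swapPairs (P : Measure 𝒳) [SigmaFinite P] (σ : Fin n → Bool) :
    MeasurePreserving (swapPairs σ) (Measure.pi fun _ => P.prod P)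
      (Measure.pi fun _ => P.prod P) := by
  refine measurePreserving_pi (fun _ => P.prod P) (fun _ => P.prod P) fun j => ?_
  change MeasurePreserving (if σ j then MeasurableEquiv.prodComm else MeasurableEquiv.refl _ :
    𝒳 × 𝒳 ≃ᵐ 𝒳 × 𝒳) (P.prod P) (P.prod P)
  cases σ j
  · exact MeasurePreserving.id _
  · exact Measure.measurePreserving_swap

theorem sum_lintegral_le_lintegral_sum {ι : Type*} (μ : Measure 𝒳) (s : Finset ι)
    (F : ι → 𝒳 → ENNReal) : ∑ i ∈ s, ∫⁻ x, F i x ∂μ ≤ ∫⁻ x, ∑ i ∈ s, F i x ∂μ := by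
  classical
  induction s using Finset.induction_on with
  | empty => simp
  | insert a s ha ih =>
    simp only [Finset.sum_insert ha]
    exact (add_le_add le_rfl ih).trans (le_lintegral_add _ _)

theorem two_pow_mul_lintegral_le_lintegral_sum_swapPairs (P : Measure 𝒳) [SigmaFinite P]
    (F : (Fin n → 𝒳 × 𝒳) → ENNReal) :
    2 ^ n * ∫⁻ z, F z ∂(Measure.pi fun _ => P.prod P)
      ≤ ∫⁻ z, ∑ σ, F (swapPairs σ z) ∂(Measure.pi fun _ => P.prod P) := by
  have hσ (σ : Fin n → Bool) : ∫⁻ z, F (swapPairs σ z) ∂(Measure.pi fun _ => P.prod P)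
      = ∫⁻ z, F z ∂(Measure.pi fun _ => P.prod P) :=
    (measurePreserving_swapPairs P σ).lintegral_comp_emb (swapPairs σ).measurableEmbedding _
  calc 2 ^ n * ∫⁻ z, F z ∂(Measure.pi fun _ => P.prod P)
      = ∑ σ : Fin n → Bool, ∫⁻ z, F (swapPairs σ z) ∂(Measure.pi fun _ => P.prod P) := by
        simp [hσ]
    _ ≤ _ := sum_lintegral_le_lintegral_sum _ _ _

variable {V : Set ℝ} {α : ℝ → ℝ → ℝ}

theorem sum_prod_exp_le_two_pow
    (hα : ∀ a ∈ V, ∀ b ∈ V, Real.exp (α a b) + Real.exp (α b a) ≤ 2)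
    {p : Fin n × Bool → ℝ} (hp : ∀ i, p i ∈ V) :
    ∑ σ : Fin n → Bool, ∏ j, Real.exp (α (p (j, !σ j)) (p (j, σ j))) ≤ 2 ^ n := by
  calc ∑ σ : Fin n → Bool, ∏ j, Real.exp (α (p (j, !σ j)) (p (j, σ j)))
      = ∏ j : Fin n, ∑ b : Bool, Real.exp (α (p (j, !b)) (p (j, b))) := by
        rw [Finset.prod_univ_sum, Fintype.piFinset_univ]
    _ ≤ ∏ _j : Fin n, 2 := by
        gcongr with j
        simpa using hα _ (hp (j, false)) _ (hp (j, true))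
    _ = 2 ^ n := by simp

theorem iSup_comp_le_sum {β : Type*} {g : Θ → β} {s : Finset β} (hs : ∀ θ, g θ ∈ s)
    (F : β → ENNReal) : ⨆ θ, F (g θ) ≤ ∑ p ∈ s, F p :=
  iSup_le fun θ => Finset.single_le_sum (fun _ _ => zero_le) (hs θ)

theorem sum_iSup_prod_exp_swapPairs_le {Γ : ℕ} {φ : Θ → 𝒳 → ℝ} (hV : ∀ θ x, φ θ x ∈ V)
    (hα : ∀ a ∈ V, ∀ b ∈ V, Real.exp (α a b) + Real.exp (α b a) ≤ 2)
    (hΓ : GrowthLE φ (2 * n) Γ) (z : Fin n → 𝒳 × 𝒳) :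
    ∑ σ, ⨆ θ, ENNReal.ofReal
        (∏ j, Real.exp (α (φ θ (swapPairs σ z j).2) (φ θ (swapPairs σ z j).1)))
      ≤ 2 ^ n * Γ := by
  let trace (θ : Θ) (i : Fin n × Bool) : ℝ := φ θ (bif i.2 then (z i.1).2 else (z i.1).1)
  have htrace : (Set.range trace).encard ≤ Γ := hΓ.encard_range_le (by simp [mul_comm]) _
  have hfin : (Set.range trace).Finite := Set.finite_of_encard_le_coe htrace
  have hcard : hfin.toFinset.card ≤ Γ := by
    rw [hfin.encard_eq_coe_toFinset_card] at htrace
    exact_mod_cast htrace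
  let F (σ : Fin n → Bool) (p : Fin n × Bool → ℝ) : ℝ :=
    ∏ j, Real.exp (α (p (j, !σ j)) (p (j, σ j)))
  have hswap (σ : Fin n → Bool) (θ : Θ) :
      ∏ j, Real.exp (α (φ θ (swapPairs σ z j).2) (φ θ (swapPairs σ z j).1)) = F σ (trace θ) := by
    refine Finset.prod_congr rfl fun j _ => ?_
    rw [swapPairs_apply]
    cases hσ : σ j <;> simp [trace]
  simp only [hswap]
  calc ∑ σ, ⨆ θ, ENNReal.ofReal (F σ (trace θ))
      ≤ ∑ σ, ∑ p ∈ hfin.toFinset, ENNReal.ofReal (F σ p) := by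
        gcongr with σ
        exact iSup_comp_le_sum (F := fun p => ENNReal.ofReal (F σ p)) (by simp)
    _ = ∑ p ∈ hfin.toFinset, ENNReal.ofReal (∑ σ, F σ p) := by
        rw [Finset.sum_comm]
        refine Finset.sum_congr rfl fun p _ => (ENNReal.ofReal_sum_of_nonneg fun σ _ => ?_).symm
        positivity
    _ ≤ ∑ p ∈ hfin.toFinset, ENNReal.ofReal (2 ^ n) := by
        gcongr with p hp
        obtain ⟨θ, rfl⟩ := hfin.mem_toFinset.1 hp
        exact sum_prod_exp_le_two_pow hα fun i => hV θ _
    _ ≤ 2 ^ n * Γ := by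
        rw [Finset.sum_const, nsmul_eq_mul, mul_comm, ENNReal.ofReal_pow zero_le_two,
          ENNReal.ofReal_ofNat]
        gcongr

/-- Exchanging a sample point with its ghost preserves the law, and by `hα` it brings the mean of
the two exponentials below one; hence each of the `Γ` patterns contributes at most one. -/
theorem lintegral_iSup_prod_exp_le {P : Measure 𝒳} [IsProbabilityMeasure P] {Γ : ℕ}
    {φ : Θ → 𝒳 → ℝ} (hV : ∀ θ x, φ θ x ∈ V)
    (hα : ∀ a ∈ V, ∀ b ∈ V, Real.exp (α a b) + Real.exp (α b a) ≤ 2)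
    (hΓ : GrowthLE φ (2 * n) Γ) :
    ∫⁻ z, (⨆ θ, ENNReal.ofReal (∏ j, Real.exp (α (φ θ (z j).2) (φ θ (z j).1))))
      ∂(Measure.pi fun _ : Fin n => P.prod P) ≤ Γ := by
  have h := (two_pow_mul_lintegral_le_lintegral_sum_swapPairs P
    fun z => ⨆ θ, ENNReal.ofReal (∏ j, Real.exp (α (φ θ (z j).2) (φ θ (z j).1)))).trans
    (lintegral_mono fun z => sum_iSup_prod_exp_swapPairs_le hV hα hΓ z)
  rw [lintegral_const, measure_univ, mul_one] at h
  exact (ENNReal.mul_le_mul_iff_right (by positivity) (by simp)).1 h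

end RandomSwaps

/-- The empirical mean of `g` over the sample `z`; it is `0` for the empty sample. -/
noncomputable def sampleMean {𝒳 : Type*} {n : ℕ} (z : Fin n → 𝒳) (g : 𝒳 → ℝ) : ℝ :=
  (∑ j, g (z j)) / n

section UniformTailBounds

variable {Ω Θ 𝒳 : Type*} [MeasurableSpace Ω] [MeasurableSpace Θ] [MeasurableSpace 𝒳]

/-- The supremum need not be measurable. Disintegrating the law of `(X, θ)` over that of `X` lets
us pass to it only once `X` and the independent variable are integrated jointly. -/
theorem lintegral_lintegral_le_lintegral_iSup [StandardBorelSpace Θ] [Nonempty Θ] {𝒲 : Type*}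
    [MeasurableSpace 𝒲] {μ : Measure Ω} [IsFiniteMeasure μ] {ν : Measure 𝒲} [SFinite ν]
    {X : Ω → 𝒳} (hX : Measurable X) {θ : Ω → Θ} (hθ : Measurable θ) {F : 𝒳 → 𝒲 → Θ → ENNReal}
    (hF : Measurable fun q : 𝒳 × 𝒲 × Θ => F q.1 q.2.1 q.2.2) :
    ∫⁻ ω, ∫⁻ y, F (X ω) y (θ ω) ∂ν ∂μ ≤ ∫⁻ z, ⨆ θ, F z.1 z.2 θ ∂((μ.map X).prod ν) := by
  set κ := condDistrib θ X μ
  have hG : Measurable fun q : 𝒳 × Θ => ∫⁻ y, F q.1 y q.2 ∂ν :=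
    Measurable.lintegral_prod_right' (f := fun p : (𝒳 × Θ) × 𝒲 => F p.1.1 p.2 p.1.2)
      (hF.comp (f := fun p : (𝒳 × Θ) × 𝒲 => (p.1.1, p.2, p.1.2)) (by fun_prop))
  have hκ : Measurable fun z : 𝒳 × 𝒲 => ∫⁻ t, F z.1 z.2 t ∂(κ z.1) :=
    Measurable.lintegral_kernel_prod_right' (κ := κ.comap Prod.fst measurable_fst)
      (f := fun p : (𝒳 × 𝒲) × Θ => F p.1.1 p.1.2 p.2)
      (hF.comp (f := fun p : (𝒳 × 𝒲) × Θ => (p.1.1, p.1.2, p.2)) (by fun_prop))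
  calc ∫⁻ ω, ∫⁻ y, F (X ω) y (θ ω) ∂ν ∂μ
      = ∫⁻ q, ∫⁻ y, F q.1 y q.2 ∂ν ∂(μ.map fun ω => (X ω, θ ω)) :=
        (lintegral_map hG (hX.prodMk hθ)).symm
    _ = ∫⁻ x, ∫⁻ t, ∫⁻ y, F x y t ∂ν ∂(κ x) ∂(μ.map X) := by
        rw [← compProd_map_condDistrib hθ.aemeasurable, Measure.lintegral_compProd hG]
    _ = ∫⁻ x, ∫⁻ y, ∫⁻ t, F x y t ∂(κ x) ∂ν ∂(μ.map X) := by
        refine lintegral_congr fun x => lintegral_lintegral_swap (f := fun t y => F x y t) ?_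
        exact (hF.comp (f := fun p : Θ × 𝒲 => (x, p.2, p.1)) (by fun_prop)).aemeasurable
    _ = ∫⁻ z, ∫⁻ t, F z.1 z.2 t ∂(κ z.1) ∂((μ.map X).prod ν) :=
        (lintegral_prod _ hκ.aemeasurable).symm
    _ ≤ ∫⁻ z, ⨆ θ, F z.1 z.2 θ ∂((μ.map X).prod ν) :=
        lintegral_mono fun z => (lintegral_mono fun t => le_iSup (F z.1 z.2) t).trans_eq (by simp)

variable {P : Measure 𝒳} [IsProbabilityMeasure P] {n Γ : ℕ}

theorem ofReal_exp_integral_le_lintegral_ofReal_exp {S : 𝒳 → ℝ} (hS : Measurable S) {K : ℝ}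
    (hK : ∀ y, |S y| ≤ K) :
    ENNReal.ofReal (Real.exp (∫ y, S y ∂P)) ≤ ∫⁻ y, ENNReal.ofReal (Real.exp (S y)) ∂P := by
  have hint : Integrable S P := .of_bound hS.aestronglyMeasurable K (.of_forall hK)
  have hexp : Integrable (fun y => Real.exp (S y)) P :=
    .of_bound (by fun_prop) (Real.exp K) (.of_forall fun y => by
      simpa using (le_abs_self _).trans (hK y))
  rw [← ofReal_integral_eq_lintegral_ofReal hexp (.of_forall fun y => (Real.exp_pos _).le)]
  exact ENNReal.ofReal_le_ofReal (convexOn_exp.map_integral_le Real.continuous_exp.continuousOn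
    isClosed_univ (by simp) hint hexp)

theorem integral_affine_sum_eq {g : 𝒳 → ℝ} (hg : Integrable g P) (z : Fin n → 𝒳) (p q r : ℝ) :
    ∫ y, ∑ j, (p * g (y j) + q * g (z j) + r) ∂(Measure.pi fun _ : Fin n => P)
      = n * (p * ∫ y, g y ∂P + q * sampleMean z g + r) := by
  have hcoord (j : Fin n) : Integrable (fun y : Fin n → 𝒳 => p * g (y j)) (Measure.pi fun _ => P) :=
    (integrable_comp_eval (μ := fun _ => P) hg).const_mul p
  have hterm (j : Fin n) : ∫ y, (p * g (y j) + q * g (z j) + r) ∂(Measure.pi fun _ : Fin n => P)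
      = p * ∫ y, g y ∂P + q * g (z j) + r := by
    simp only [add_assoc]
    rw [integral_add (hcoord j) (integrable_const _), integral_const_mul,
      integral_comp_eval (μ := fun _ : Fin n => P) hg.aestronglyMeasurable]
    simp
  rw [integral_finsetSum]
  swap
  · exact fun j _ => ((hcoord j).add (integrable_const _)).add (integrable_const _)
  have hmean : (n : ℝ) * sampleMean z g = ∑ j, g (z j) := by
    rcases n.eq_zero_or_pos with rfl | hn
    · simp
    · rw [sampleMean]
      field_simp
  simp only [hterm, Finset.sum_add_distrib, Finset.sum_const, Finset.card_univ, Fintype.card_fin,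
    nsmul_eq_mul, ← Finset.mul_sum, ← hmean]
  ring

theorem abs_sum_affine_le {ι 𝒴 : Type*} (s : Finset ι) {g : 𝒴 → ℝ} (hg : ∀ x, |g x| ≤ 1)
    (y z : ι → 𝒴) (p q r : ℝ) :
    |∑ j ∈ s, (p * g (y j) + q * g (z j) + r)| ≤ s.card * (|p| + |q| + |r|) := by
  rw [← nsmul_eq_mul]
  refine (Finset.abs_sum_le_sum_abs _ _).trans (Finset.sum_le_card_nsmul _ _ _ fun j _ => ?_)
  refine (abs_add_three _ _ _).trans ?_
  rw [abs_mul, abs_mul]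
  gcongr
  · exact mul_le_of_le_one_right (abs_nonneg _) (hg _)
  · exact mul_le_of_le_one_right (abs_nonneg _) (hg _)

variable [StandardBorelSpace Θ] [Nonempty Θ] {μ : Measure Ω} [IsProbabilityMeasure μ]
  {X : Ω → Fin n → 𝒳} {θ : Ω → Θ} {φ : Θ → 𝒳 → ℝ}

theorem lintegral_exp_affine_le (hX : Measurable X) (hlaw : μ.map X = Measure.pi fun _ => P)
    (hθ : Measurable θ) (hφ : Measurable (Function.uncurry φ)) {V : Set ℝ}
    (hV : ∀ θ x, φ θ x ∈ V) (hΓ : GrowthLE φ (2 * n) Γ) {p q r : ℝ}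
    (hpqr : ∀ a ∈ V, ∀ b ∈ V,
      Real.exp (p * a + q * b + r) + Real.exp (p * b + q * a + r) ≤ 2) :
    ∫⁻ ω, ∫⁻ y, ENNReal.ofReal
        (Real.exp (∑ j, (p * φ (θ ω) (y j) + q * φ (θ ω) (X ω j) + r)))
      ∂(Measure.pi fun _ : Fin n => P) ∂μ ≤ Γ := by
  let F (x y : Fin n → 𝒳) (t : Θ) : ENNReal :=
    ENNReal.ofReal (Real.exp (∑ j, (p * φ t (y j) + q * φ t (x j) + r)))
  have hF : Measurable fun u : (Fin n → 𝒳) × (Fin n → 𝒳) × Θ => F u.1 u.2.1 u.2.2 := by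
    have (j : Fin n) : Measurable fun u : (Fin n → 𝒳) × (Fin n → 𝒳) × Θ => φ u.2.2 (u.1 j) :=
      hφ.comp (f := fun u : (Fin n → 𝒳) × (Fin n → 𝒳) × Θ => (u.2.2, u.1 j)) (by fun_prop)
    have (j : Fin n) : Measurable fun u : (Fin n → 𝒳) × (Fin n → 𝒳) × Θ => φ u.2.2 (u.2.1 j) :=
      hφ.comp (f := fun u : (Fin n → 𝒳) × (Fin n → 𝒳) × Θ => (u.2.2, u.2.1 j)) (by fun_prop)
    fun_prop
  calc ∫⁻ ω, ∫⁻ y, F (X ω) y (θ ω) ∂(Measure.pi fun _ : Fin n => P) ∂μ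
      ≤ ∫⁻ z, ⨆ t, F z.1 z.2 t ∂((Measure.pi fun _ => P).prod (Measure.pi fun _ => P)) := by
        rw [← hlaw]
        exact lintegral_lintegral_le_lintegral_iSup hX hθ hF
    _ = ∫⁻ z, ⨆ t, F (fun j => (z j).1) (fun j => (z j).2) t
          ∂(Measure.pi fun _ : Fin n => P.prod P) := by
        rw [← (measurePreserving_arrowProdEquivProdArrow 𝒳 𝒳 (Fin n) (fun _ => P)
          (fun _ => P)).lintegral_comp_emb (MeasurableEquiv.measurableEmbedding _)]
        rfl
    _ ≤ Γ := by
        simp only [F, Real.exp_sum]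
        exact lintegral_iSup_prod_exp_le (α := fun a b => p * a + q * b + r) hV hpqr hΓ

/-- Uniform over the class, since `θ` may depend on the sample. -/
theorem measure_le_affine_deviation_le (hX : Measurable X)
    (hlaw : μ.map X = Measure.pi fun _ => P) (hθ : Measurable θ)
    (hφ : Measurable (Function.uncurry φ)) {V : Set ℝ} (hV : ∀ θ x, φ θ x ∈ V)
    (hV1 : ∀ a ∈ V, |a| ≤ 1) (hΓ : GrowthLE φ (2 * n) Γ) {p q r : ℝ}
    (hpqr : ∀ a ∈ V, ∀ b ∈ V,
      Real.exp (p * a + q * b + r) + Real.exp (p * b + q * a + r) ≤ 2) (L : ℝ) :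
    μ.real {ω | L ≤ n * (p * ∫ y, φ (θ ω) y ∂P + q * sampleMean (X ω) (φ (θ ω)) + r)}
      ≤ Γ * Real.exp (-L) := by
  let G (ω : Ω) : ENNReal := ∫⁻ y, ENNReal.ofReal
    (Real.exp (∑ j, (p * φ (θ ω) (y j) + q * φ (θ ω) (X ω j) + r)))
    ∂(Measure.pi fun _ : Fin n => P)
  have hGm : Measurable G := by
    have (j : Fin n) : Measurable fun u : Ω × (Fin n → 𝒳) => φ (θ u.1) (u.2 j) :=
      hφ.comp (f := fun u : Ω × (Fin n → 𝒳) => (θ u.1, u.2 j)) (by fun_prop)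
    have (j : Fin n) : Measurable fun u : Ω × (Fin n → 𝒳) => φ (θ u.1) (X u.1 j) :=
      hφ.comp (f := fun u : Ω × (Fin n → 𝒳) => (θ u.1, X u.1 j)) (by fun_prop)
    exact Measurable.lintegral_prod_right' (f := fun u : Ω × (Fin n → 𝒳) => ENNReal.ofReal
      (Real.exp (∑ j, (p * φ (θ u.1) (u.2 j) + q * φ (θ u.1) (X u.1 j) + r)))) (by fun_prop)
  have hsub : {ω | L ≤ n * (p * ∫ y, φ (θ ω) y ∂P + q * sampleMean (X ω) (φ (θ ω)) + r)}
      ⊆ {ω | ENNReal.ofReal (Real.exp L) ≤ G ω} := by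
    intro ω hω
    have hm : Measurable (φ (θ ω)) := hφ.comp (by fun_prop : Measurable fun y => (θ ω, y))
    have hb (x : 𝒳) : |φ (θ ω) x| ≤ 1 := hV1 _ (hV _ _)
    refine le_trans ?_ (ofReal_exp_integral_le_lintegral_ofReal_exp (by fun_prop)
      fun y => abs_sum_affine_le Finset.univ hb y (X ω) p q r)
    rw [integral_affine_sum_eq (.of_bound hm.aestronglyMeasurable 1 (.of_forall hb))]
    exact ENNReal.ofReal_le_ofReal (Real.exp_le_exp.2 hω)
  refine ENNReal.toReal_le_of_le_ofReal (by positivity) ?_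
  calc μ _ ≤ μ {ω | ENNReal.ofReal (Real.exp L) ≤ G ω} := measure_mono hsub
    _ ≤ (∫⁻ ω, G ω ∂μ) / ENNReal.ofReal (Real.exp L) :=
        meas_ge_le_lintegral_div hGm.aemeasurable (by simp [Real.exp_pos]) ENNReal.ofReal_ne_top
    _ ≤ Γ / ENNReal.ofReal (Real.exp L) := by
        gcongr
        exact lintegral_exp_affine_le hX hlaw hθ hφ hV hΓ hpqr
    _ = ENNReal.ofReal (Γ * Real.exp (-L)) := by
        rw [Real.exp_neg, ← div_eq_mul_inv, ENNReal.ofReal_div_of_pos (Real.exp_pos _),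
          ENNReal.ofReal_natCast]

end UniformTailBounds

section Deviations

theorem exp_add_exp_le_two {x y : ℝ} (h : 4 * (x + y) + (x - y) ^ 2 ≤ 0) :
    Real.exp x + Real.exp y ≤ 2 := by
  have hcosh :
      Real.exp x + Real.exp y = 2 * (Real.exp ((x + y) / 2) * Real.cosh ((x - y) / 2)) := by
    rw [Real.cosh_eq, mul_div_assoc', mul_div_cancel₀ _ two_ne_zero, mul_add, ← Real.exp_add,
      ← Real.exp_add]
    ring_nf
  calc Real.exp x + Real.exp y
      ≤ 2 * (Real.exp ((x + y) / 2) * Real.exp (((x - y) / 2) ^ 2 / 2)) := by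
        rw [hcosh]
        gcongr
        exact Real.cosh_le_exp_half_sq _
    _ ≤ 2 := by
        rw [← Real.exp_add]
        have := Real.exp_le_one_iff.2 (show (x + y) / 2 + ((x - y) / 2) ^ 2 / 2 ≤ 0 by linarith)
        linarith

theorem exp_sub_sq_add_exp_neg_le_two {l : ℝ} (hl : 0 ≤ l) :
    Real.exp (l - l ^ 2) + Real.exp (-l) ≤ 2 := by
  rcases le_total l 4 with h4 | h4
  · refine exp_add_exp_le_two ?_
    have : 0 ≤ l ^ 3 * (4 - l) := by have := sub_nonneg.2 h4; positivity
    linarith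
  · have h₁ : Real.exp (l - l ^ 2) ≤ 1 := Real.exp_le_one_iff.2 (by nlinarith)
    have h₂ : Real.exp (-l) ≤ 1 := Real.exp_le_one_iff.2 (by linarith)
    linarith

variable {Ω Θ 𝒳 : Type*} [MeasurableSpace Ω] [MeasurableSpace Θ] [StandardBorelSpace Θ]
  [Nonempty Θ] [MeasurableSpace 𝒳] {μ : Measure Ω} [IsProbabilityMeasure μ] {P : Measure 𝒳}
  [IsProbabilityMeasure P] {n Γ : ℕ} {X : Ω → Fin n → 𝒳} {θ : Ω → Θ} {φ : Θ → 𝒳 → ℝ}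

theorem measure_lower_relative_deviation_le (hX : Measurable X)
    (hlaw : μ.map X = Measure.pi fun _ => P) (hθ : Measurable θ)
    (hφ : Measurable (Function.uncurry φ)) (hV : ∀ t x, φ t x ∈ ({0, 1} : Set ℝ))
    (hΓ : GrowthLE φ (2 * n) Γ) (hn : 0 < n) {l : ℝ} (hl : 0 < l) (L : ℝ) :
    μ.real {ω | l * ∫ y, φ (θ ω) y ∂P + L / (n * l)
        ≤ ∫ y, φ (θ ω) y ∂P - sampleMean (X ω) (φ (θ ω))} ≤ Γ * Real.exp (-L) := by
  have hn' : (0 : ℝ) < n := by exact_mod_cast hn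
  refine (measureReal_mono fun ω hω => ?_).trans (measure_le_affine_deviation_le hX hlaw hθ hφ hV
    (by simp) hΓ (p := l - l ^ 2) (q := -l) (r := 0) ?_ L)
  · have h := mul_le_mul_of_nonneg_left (Set.mem_ofPred.1 hω) (mul_pos hn' hl).le
    have hL : n * l * (L / (n * l)) = L := by field_simp
    rw [Set.mem_ofPred_eq]
    linarith
  · have hl' := exp_sub_sq_add_exp_neg_le_two hl.le
    have hsq : Real.exp (l - l ^ 2 + -l) ≤ 1 := Real.exp_le_one_iff.2 (by nlinarith)
    rintro a (rfl | rfl) b (rfl | rfl) <;> norm_num <;> linarith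

theorem measure_upper_relative_deviation_le (hX : Measurable X)
    (hlaw : μ.map X = Measure.pi fun _ => P) (hθ : Measurable θ)
    (hφ : Measurable (Function.uncurry φ)) (hV : ∀ t x, φ t x ∈ ({0, 1} : Set ℝ))
    (hΓ : GrowthLE φ (2 * n) Γ) (hn : 0 < n) {l : ℝ} (hl : 0 < l) (L : ℝ) :
    μ.real {ω | l * sampleMean (X ω) (φ (θ ω)) + L / (n * l)
        ≤ sampleMean (X ω) (φ (θ ω)) - ∫ y, φ (θ ω) y ∂P} ≤ Γ * Real.exp (-L) := by
  have hn' : (0 : ℝ) < n := by exact_mod_cast hn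
  refine (measureReal_mono fun ω hω => ?_).trans (measure_le_affine_deviation_le hX hlaw hθ hφ hV
    (by simp) hΓ (p := -l) (q := l - l ^ 2) (r := 0) ?_ L)
  · have h := mul_le_mul_of_nonneg_left (Set.mem_ofPred.1 hω) (mul_pos hn' hl).le
    have hL : n * l * (L / (n * l)) = L := by field_simp
    rw [Set.mem_ofPred_eq]
    linarith
  · have hl' := exp_sub_sq_add_exp_neg_le_two hl.le
    have hsq : Real.exp (-l + (l - l ^ 2)) ≤ 1 := Real.exp_le_one_iff.2 (by nlinarith)
    rintro a (rfl | rfl) b (rfl | rfl) <;> norm_num <;> linarith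

theorem measure_deviation_le (hX : Measurable X) (hlaw : μ.map X = Measure.pi fun _ => P)
    (hθ : Measurable θ) (hφ : Measurable (Function.uncurry φ)) (hV : ∀ t x, |φ t x| ≤ 1)
    (hΓ : GrowthLE φ (2 * n) Γ) (hn : 0 < n) {L : ℝ} (hL : 0 ≤ L) :
    μ.real {ω | √(8 * L / n) ≤ sampleMean (X ω) (φ (θ ω)) - ∫ y, φ (θ ω) y ∂P}
      ≤ Γ * Real.exp (-L) := by
  have hn' : (0 : ℝ) < n := by exact_mod_cast hn
  set s := √(8 * L / n) with hs
  have hs0 : 0 ≤ s := Real.sqrt_nonneg _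
  refine (measureReal_mono fun ω hω => ?_).trans (measure_le_affine_deviation_le hX hlaw hθ hφ
    (V := {a | |a| ≤ 1}) hV (fun _ ha => ha) hΓ (p := -(s / 4)) (q := s / 4)
    (r := -2 * (s / 4) ^ 2) ?_ L)
  · have h := mul_le_mul_of_nonneg_left (Set.mem_ofPred.1 hω) (mul_nonneg hn'.le hs0)
    have hs2 : n * s ^ 2 = 8 * L := by
      rw [hs, Real.sq_sqrt (by positivity)]
      field_simp
    rw [Set.mem_ofPred_eq]
    linarith
  · intro a ha b hb
    refine exp_add_exp_le_two ?_
    have hab : (a - b) ^ 2 ≤ 4 := by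
      have := abs_le.1 (show |a| ≤ 1 from ha)
      have := abs_le.1 (show |b| ≤ 1 from hb)
      nlinarith
    nlinarith [sq_nonneg s]

end Deviations

section Halfspaces

variable {F ι : Type*} [NormedAddCommGroup F] [InnerProductSpace ℝ F]

/-- `u` is the trace on the points `y` of a halfspace `{z | t ≤ ⟪w, z⟫}` whose complement contains
the origin. -/
def IsHalfspaceTrace (y : ι → F) (u : Finset ι) : Prop :=
  ∃ (w : F) (t : ℝ), 0 < t ∧ ∀ q, q ∈ u ↔ t ≤ inner ℝ w (y q)

/-- Radon's theorem for the `s.card + 1` points formed by the origin and the `y q`, `q ∈ s`. -/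
theorem card_le_finrank_of_shatters [DecidableEq ι] [FiniteDimensional ℝ F] {y : ι → F}
    {𝒜 : Finset (Finset ι)} (h𝒜 : ∀ u ∈ 𝒜, IsHalfspaceTrace y u) {s : Finset ι}
    (hs : 𝒜.Shatters s) : s.card ≤ Module.finrank ℝ F := by
  classical
  by_contra! hcard
  let f : Option s → F := fun o => o.elim 0 fun q => y q
  have hdep : ¬ AffineIndependent ℝ f := fun hf => by
    have h := hf.card_le_finrank_succ.trans (Nat.succ_le_succ (Submodule.finrank_le _))
    simp only [Fintype.card_option, Fintype.card_coe] at h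
    omega
  obtain ⟨I, hI, hnone⟩ : ∃ I : Set (Option s),
      (convexHull ℝ (f '' I) ∩ convexHull ℝ (f '' Iᶜ)).Nonempty ∧ none ∉ I := by
    obtain ⟨I, hI⟩ := Convex.radon_partition hdep
    by_cases hnone : none ∈ I
    · exact ⟨Iᶜ, by rwa [compl_compl, Set.inter_comm], by simpa using hnone⟩
    · exact ⟨I, hI, hnone⟩
  obtain ⟨u, hu, hsu⟩ := hs (t := (Finset.univ.filter fun q : s => some q ∈ I).map
    (Function.Embedding.subtype _)) (Finset.map_subtype_subset _)
  obtain ⟨w, t, ht, hwt⟩ := h𝒜 u hu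
  have hI_iff (q : s) : t ≤ inner ℝ w (y q) ↔ some q ∈ I := by
    have : (q : ι) ∈ s ∩ u ↔ (q : ι) ∈ u := by simp
    rw [← hwt, ← this, hsu]
    simp
  have hlin : IsLinearMap ℝ fun z : F => inner ℝ w z := (innerₛₗ ℝ w).isLinear
  have hin : convexHull ℝ (f '' I) ⊆ {z | t ≤ inner ℝ w z} := by
    refine convexHull_min ?_ (convex_halfSpace_ge hlin t)
    rintro _ ⟨_ | q, hq, rfl⟩
    exacts [absurd hq hnone, (hI_iff q).2 hq]
  have hout : convexHull ℝ (f '' Iᶜ) ⊆ {z | inner ℝ w z < t} := by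
    refine convexHull_min ?_ (convex_halfSpace_lt hlin t)
    rintro _ ⟨_ | q, hq, rfl⟩
    · simpa [f] using ht
    · exact not_le.1 fun h => hq ((hI_iff q).1 h)
  obtain ⟨z, hz₁, hz₂⟩ := hI
  exact (Set.mem_ofPred.1 (hin hz₁)).not_gt (Set.mem_ofPred.1 (hout hz₂))

theorem card_le_of_isHalfspaceTrace [Fintype ι] [FiniteDimensional ℝ F] {y : ι → F}
    {𝒜 : Finset (Finset ι)} (h𝒜 : ∀ u ∈ 𝒜, IsHalfspaceTrace y u) :
    𝒜.card ≤ ∑ i ∈ Finset.Iic (Module.finrank ℝ F), (Fintype.card ι).choose i := by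
  classical
  refine 𝒜.card_le_card_shatterer.trans (Finset.card_shatterer_le_sum_vcDim.trans ?_)
  exact Finset.sum_le_sum_of_subset (Finset.Iic_subset_Iic.2 (Finset.sup_le fun s hs =>
    card_le_finrank_of_shatters h𝒜 (Finset.mem_shatterer.1 hs)))

open scoped Classical in
theorem isHalfspaceTrace_filter [Fintype ι] (y : ι → F) (w : F) (t : EReal) :
    IsHalfspaceTrace y (Finset.univ.filter fun q =>
      0 < inner ℝ w (y q) ∧ t ≤ ((inner ℝ w (y q) : ℝ) : EReal)) := by
  set s := Finset.univ.filter fun q =>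
    0 < inner ℝ w (y q) ∧ t ≤ ((inner ℝ w (y q) : ℝ) : EReal)
  rcases s.eq_empty_or_nonempty with hempty | hne
  · exact ⟨0, 1, one_pos, by simp [hempty]⟩
  · obtain ⟨q₀, hq₀, hmin⟩ := s.exists_min_image (fun q => inner ℝ w (y q)) hne
    obtain ⟨hpos, ht⟩ := (Finset.mem_filter.1 hq₀).2
    exact ⟨w, _, hpos, fun q => ⟨hmin q, fun h => Finset.mem_filter.2
      ⟨Finset.mem_univ q, hpos.trans_le h, ht.trans (EReal.coe_le_coe_iff.2 h)⟩⟩⟩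

end Halfspaces

section DecisionGrowth

variable {d : ℕ}

open scoped Classical in
/-- The output of the pair `p = (w, t)` on `x`: the label `h_w(x)`, or `none` for abstaining. -/
noncomputable def decision (p : E d × EReal) (x : E d) : Option SignType :=
  if Accepts p.1 p.2 x then some (linClassifier p.1 x) else none

open scoped Classical in
theorem decision_eq (w : E d) (t : EReal) (x : E d) : decision (w, t) x =
    if 0 < inner ℝ w x ∧ t ≤ ((inner ℝ w x : ℝ) : EReal) then some 1
    else if 0 < inner ℝ w (-x) ∧ t ≤ ((inner ℝ w (-x) : ℝ) : EReal) then some (-1)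
    else if 0 < t then none else some 0 := by
  simp only [decision, Accepts, margin, linClassifier, inner_neg_right]
  rcases lt_trichotomy (inner ℝ w x) 0 with ha | ha | ha
  · by_cases h : t ≤ ((-inner ℝ w x : ℝ) : EReal)
    · simp only [abs_of_neg ha, h, ha.not_gt, neg_pos.2 ha, sign_neg ha, and_self, false_and,
        if_true, if_false]
    · have ht : 0 < t := (EReal.coe_pos.2 (neg_pos.2 ha)).trans (not_le.1 h)
      simp only [abs_of_neg ha, h, ha.not_gt, ht, and_false, false_and, if_true, if_false]
  · simp [ha, ← not_lt]
  · by_cases h : t ≤ ((inner ℝ w x : ℝ) : EReal)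
    · simp only [abs_of_pos ha, h, ha, sign_pos ha, and_self, if_true]
    · have ht : 0 < t := (EReal.coe_pos.2 ha).trans (not_le.1 h)
      simp only [abs_of_pos ha, h, (neg_neg_of_pos ha).not_gt, ht, and_false, false_and, if_true,
        if_false]

/-- The factors `2` account for the sign of the threshold and for the reflected points. -/
theorem growthLE_decision (d m : ℕ) :
    GrowthLE (decision (d := d)) m (2 * ∑ i ∈ Finset.Iic d, (2 * m).choose i) := by
  classical
  intro Z
  let Y (q : Fin m × Bool) : E d := if q.2 then Z q.1 else -Z q.1
  let trace (p : E d × EReal) : Finset (Fin m × Bool) := Finset.univ.filter fun q =>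
    0 < inner ℝ p.1 (Y q) ∧ p.2 ≤ ((inner ℝ p.1 (Y q) : ℝ) : EReal)
  let 𝒜 : Finset (Finset (Fin m × Bool)) := Finset.univ.filter (IsHalfspaceTrace Y)
  have h𝒜 : 𝒜.card ≤ ∑ i ∈ Finset.Iic d, (2 * m).choose i := by
    simpa [mul_comm] using card_le_of_isHalfspaceTrace (𝒜 := 𝒜) fun u hu =>
      (Finset.mem_filter.1 hu).2
  have hfactor : (fun p j => decision p (Z j)).FactorsThrough
      fun p : E d × EReal => (trace p, decide (0 < p.2)) := by
    have hdecision (p : E d × EReal) (j : Fin m) : decision p (Z j) =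
        if (j, true) ∈ trace p then some 1 else if (j, false) ∈ trace p then some (-1)
        else if decide (0 < p.2) then none else some 0 := by
      simpa [trace, Y] using decision_eq p.1 p.2 (Z j)
    intro p p' h
    obtain ⟨h₁, h₂⟩ := Prod.mk.injEq _ _ _ _ ▸ h
    funext j
    simp only [hdecision, h₁, h₂]
  have hsub : (Set.range fun p : E d × EReal => (trace p, decide (0 < p.2))) ⊆
      ((𝒜 ×ˢ Finset.univ : Finset (Finset (Fin m × Bool) × Bool)) : Set _) := by
    rintro _ ⟨p, rfl⟩
    simpa [𝒜, lt_or_ge] using isHalfspaceTrace_filter Y p.1 p.2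
  calc (Set.range fun p j => decision p (Z j)).encard
      ≤ ((𝒜 ×ˢ Finset.univ : Finset (Finset (Fin m × Bool) × Bool)) : Set _).encard :=
        (encard_range_le_of_factorsThrough hfactor).trans (Set.encard_le_encard hsub)
    _ = (2 * 𝒜.card : ℕ) := by
        rw [Set.encard_coe_eq_coe_finsetCard, Finset.card_product, mul_comm, Finset.card_univ,
          Fintype.card_bool]
    _ ≤ _ := by exact_mod_cast Nat.mul_le_mul_left 2 h𝒜

theorem sum_choose_le_exp_mul_div_pow {m : ℕ} (hd : 1 ≤ d) (hm : d ≤ m) :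
    (∑ i ∈ Finset.Iic d, (m.choose i : ℝ)) ≤ (Real.exp 1 * m / d) ^ d := by
  have : (0 : ℝ) < d := by exact_mod_cast hd
  have hm0 : (0 : ℝ) < m := by exact_mod_cast hd.trans hm
  have hle : (d : ℝ) / m ≤ 1 := (div_le_one hm0).2 (by exact_mod_cast hm)
  have hexp : (∑ i ∈ Finset.Iic d, (m.choose i : ℝ)) * (d / m) ^ d ≤ Real.exp 1 ^ d := by
    calc (∑ i ∈ Finset.Iic d, (m.choose i : ℝ)) * (d / m) ^ d
        = ∑ i ∈ Finset.Iic d, (m.choose i : ℝ) * (d / m) ^ d := Finset.sum_mul ..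
      _ ≤ ∑ i ∈ Finset.Iic d, (m.choose i : ℝ) * (d / m) ^ i := by
          refine Finset.sum_le_sum fun i hi => mul_le_mul_of_nonneg_left ?_ (by positivity)
          exact pow_le_pow_of_le_one (by positivity) hle (Finset.mem_Iic.1 hi)
      _ ≤ ∑ i ∈ Finset.range (m + 1), (m.choose i : ℝ) * (d / m) ^ i := by
          refine Finset.sum_le_sum_of_subset_of_nonneg (fun i hi => ?_) fun _ _ _ => by positivity
          exact Finset.mem_range.2 (by have := Finset.mem_Iic.1 hi; omega)
      _ = ((d : ℝ) / m + 1) ^ m := by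
          rw [add_pow]
          exact Finset.sum_congr rfl fun i _ => by simp [mul_comm]
      _ ≤ Real.exp ((d : ℝ) / m) ^ m := by
          gcongr
          exact Real.add_one_le_exp _
      _ = Real.exp 1 ^ d := by
          rw [← Real.exp_nat_mul, ← Real.exp_nat_mul]
          field_simp
  rwa [← le_div_iff₀ (by positivity), ← div_pow, div_div_eq_mul_div] at hexp

/-- The bound on the growth of `decision` on a sample of size `n` together with a ghost sample of
the same size. -/
noncomputable def roundGrowth (d n : ℕ) : ℕ := 2 * ∑ i ∈ Finset.Iic d, (2 * (2 * n)).choose i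

theorem three_mul_roundGrowth_le {n : ℕ} (hd : 1 ≤ d) (hn : 16 * d ≤ n) :
    3 * (roundGrowth d n : ℝ) ≤ Real.exp (2 * d * Real.log (Real.exp 1 * n / d)) := by
  have hd0 : (0 : ℝ) < d := by exact_mod_cast hd
  have hn1 : (16 : ℝ) * d ≤ n := by exact_mod_cast hn
  have hn0 : (0 : ℝ) < n := by linarith
  set a := Real.exp 1 * n / d with ha
  have ha0 : 0 < a := by positivity
  have ha24 : 24 ≤ a := by
    rw [ha, le_div_iff₀ hd0]
    nlinarith [Real.exp_one_gt_d9]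
  have hchoose : (∑ i ∈ Finset.Iic d, ((2 * (2 * n)).choose i : ℝ)) ≤ (4 * a) ^ d := by
    convert sum_choose_le_exp_mul_div_pow (m := 2 * (2 * n)) hd (by omega) using 2
    rw [ha]
    push_cast
    ring
  have hexp : Real.exp (2 * d * Real.log a) = (a ^ 2) ^ d := by
    rw [← pow_mul, ← Real.rpow_natCast, Real.rpow_def_of_pos ha0]
    push_cast
    ring_nf
  calc 3 * (roundGrowth d n : ℝ) = 6 * ∑ i ∈ Finset.Iic d, ((2 * (2 * n)).choose i : ℝ) := by
        simp only [roundGrowth]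
        push_cast
        ring
    _ ≤ 6 ^ d * (4 * a) ^ d := by
        gcongr
        exact le_self_pow₀ (by norm_num) (by omega)
    _ = (24 * a) ^ d := by
        rw [← mul_pow]
        ring
    _ ≤ Real.exp (2 * d * Real.log a) := by
        rw [hexp]
        gcongr
        nlinarith

end DecisionGrowth

section UnitBall

theorem volume_real_closedBall_one (n : ℕ) :
    (volume : Measure (E n)).real (Metric.closedBall 0 1) =
      √Real.pi ^ n / Real.Gamma (n / 2 + 1) := by
  rcases Nat.eq_zero_or_pos n with rfl | hn
  · simp [Measure.real, volume_euclideanSpace_eq_dirac]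
  · have : Nonempty (Fin n) := ⟨⟨0, hn⟩⟩
    rw [Measure.real, EuclideanSpace.volume_closedBall]
    simp only [ENNReal.ofReal_one, one_pow, one_mul, Fintype.card_fin]
    exact ENNReal.toReal_ofReal (by positivity)

theorem gamma_add_half_le {a : ℝ} (ha : 0 < a) :
    Real.Gamma (a + 1 / 2) ≤ √a * Real.Gamma a := by
  have hconvex := Real.Gamma_mul_add_mul_le_rpow_Gamma_mul_rpow_Gamma ha (add_pos ha one_pos)
    one_half_pos one_half_pos (add_halves 1)
  calc Real.Gamma (a + 1 / 2) = Real.Gamma (1 / 2 * a + 1 / 2 * (a + 1)) := by ring_nf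
    _ ≤ √(Real.Gamma a) * (√a * √(Real.Gamma a)) := by
        rwa [Real.Gamma_add_one ha.ne', ← Real.sqrt_eq_rpow, ← Real.sqrt_eq_rpow,
          Real.sqrt_mul ha.le] at hconvex
    _ = √a * Real.Gamma a := by
        rw [mul_left_comm, Real.mul_self_sqrt (Real.Gamma_pos_of_pos ha).le]

theorem volume_real_closedBall_le_succ (n : ℕ) :
    (volume : Measure (E n)).real (Metric.closedBall 0 1) ≤
      √((n + 1 : ℕ) / Real.pi) * (volume : Measure (E (n + 1))).real (Metric.closedBall 0 1) := by
  have hG : 0 < Real.Gamma (n / 2 + 1) := Real.Gamma_pos_of_pos (by positivity)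
  have hG' : 0 < Real.Gamma ((n + 1 : ℕ) / 2 + 1) := Real.Gamma_pos_of_pos (by positivity)
  have : 0 < √Real.pi := Real.sqrt_pos.2 Real.pi_pos
  have hle : Real.Gamma ((n + 1 : ℕ) / 2 + 1) ≤ √(n + 1 : ℕ) * Real.Gamma (n / 2 + 1) := by
    calc Real.Gamma ((n + 1 : ℕ) / 2 + 1) = Real.Gamma ((n / 2 + 1 : ℝ) + 1 / 2) := by
          push_cast
          ring_nf
      _ ≤ √(n / 2 + 1 : ℝ) * Real.Gamma (n / 2 + 1) := gamma_add_half_le (by positivity)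
      _ ≤ √(n + 1 : ℕ) * Real.Gamma (n / 2 + 1) := by
          gcongr
          push_cast
          linarith [(Nat.cast_nonneg n : (0 : ℝ) ≤ n)]
  rw [volume_real_closedBall_one, volume_real_closedBall_one]
  calc √Real.pi ^ n / Real.Gamma (n / 2 + 1)
      ≤ √Real.pi ^ n * (√(n + 1 : ℕ) / Real.Gamma ((n + 1 : ℕ) / 2 + 1)) := by
        rw [div_eq_mul_one_div]
        refine mul_le_mul_of_nonneg_left ?_ (by positivity)
        rwa [div_le_div_iff₀ hG hG', one_mul]
    _ = √((n + 1 : ℕ) / Real.pi) * (√Real.pi ^ (n + 1) / Real.Gamma ((n + 1 : ℕ) / 2 + 1)) := by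
        rw [Real.sqrt_div (by positivity), pow_succ]
        field_simp

theorem measurableSet_coordinate_slab (n : ℕ) (t : ℝ) :
    MeasurableSet {y : E (n + 1) | ‖y‖ ≤ 1 ∧ |y 0| < t} :=
  (measurableSet_le measurable_norm measurable_const).inter
    (measurableSet_lt (by fun_prop : Measurable fun y : E (n + 1) => |y 0|) measurable_const)

theorem volume_coordinate_slab_le (n : ℕ) (t : ℝ) :
    volume {y : E (n + 1) | ‖y‖ ≤ 1 ∧ |y 0| < t} ≤
      ENNReal.ofReal (2 * t) * volume (Metric.closedBall (0 : E n) 1) := by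
  let B : Set (Fin n → ℝ) := WithLp.toLp 2 ⁻¹' Metric.closedBall (0 : E n) 1
  let e := MeasurableEquiv.piFinSuccAbove (fun _ : Fin (n + 1) => ℝ) 0
  have hsub : WithLp.toLp 2 ⁻¹' {y : E (n + 1) | ‖y‖ ≤ 1 ∧ |y 0| < t} ⊆
      e ⁻¹' (Set.Ioo (-t) t ×ˢ B) := by
    rintro y ⟨hnorm, hslab⟩
    refine ⟨abs_lt.1 hslab, mem_closedBall_zero_iff.2 (le_trans ?_ hnorm)⟩
    rw [EuclideanSpace.norm_eq, EuclideanSpace.norm_eq, Fin.sum_univ_succ (n := n)]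
    exact Real.sqrt_le_sqrt (le_add_of_nonneg_left (by positivity))
  calc volume {y : E (n + 1) | ‖y‖ ≤ 1 ∧ |y 0| < t}
      = volume (WithLp.toLp 2 ⁻¹' {y : E (n + 1) | ‖y‖ ≤ 1 ∧ |y 0| < t}) :=
        ((PiLp.volume_preserving_toLp _).measure_preimage
          (measurableSet_coordinate_slab n t).nullMeasurableSet).symm
    _ ≤ volume (e ⁻¹' (Set.Ioo (-t) t ×ˢ B)) := measure_mono hsub
    _ = volume (Set.Ioo (-t) t) * volume B := by
        rw [(volume_preserving_piFinSuccAbove (fun _ => ℝ) 0).measure_preimage_equiv,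
          Measure.volume_eq_prod, Measure.prod_prod]
    _ = ENNReal.ofReal (2 * t) * volume (Metric.closedBall (0 : E n) 1) := by
        rw [Real.volume_Ioo, sub_neg_eq_add, ← two_mul,
          (PiLp.volume_preserving_toLp (Fin n)).measure_preimage
            Metric.isClosed_closedBall.measurableSet.nullMeasurableSet]

theorem volume_closedBall_inter_slab_le {n : ℕ} {w : E (n + 1)} (hw : ‖w‖ = 1) (t : ℝ) :
    volume (Metric.closedBall (0 : E (n + 1)) 1 ∩ {x | margin w x < t}) ≤
      ENNReal.ofReal (2 * t) * volume (Metric.closedBall (0 : E n) 1) := by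
  obtain ⟨b, hb⟩ := Orthonormal.exists_orthonormalBasis_extension_of_card_eq (𝕜 := ℝ)
    (ι := Fin (n + 1)) (E := E (n + 1)) (by simp) (v := fun _ => w) (s := {0})
    ⟨fun _ => hw, fun i j hij => absurd (Subsingleton.elim i j) hij⟩
  have hslab : Metric.closedBall (0 : E (n + 1)) 1 ∩ {x | margin w x < t} =
      b.repr ⁻¹' {y : E (n + 1) | ‖y‖ ≤ 1 ∧ |y 0| < t} := by
    ext x
    simp [margin, b.repr_apply_apply, hb 0 rfl]
  rw [hslab, b.measurePreserving_repr.measure_preimage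
    (measurableSet_coordinate_slab n t).nullMeasurableSet]
  exact volume_coordinate_slab_le n t

instance isProbabilityMeasure_unifBall (d : ℕ) : IsProbabilityMeasure (unifBall d) :=
  cond_isProbabilityMeasure_of_finite (Metric.measure_closedBall_pos _ _ one_pos).ne'
    measure_closedBall_lt_top.ne

theorem real_cond_apply {Ω : Type*} [MeasurableSpace Ω] {μ : Measure Ω} {s : Set Ω}
    (hs : MeasurableSet s) (t : Set Ω) : μ[|s].real t = (μ.real s)⁻¹ * μ.real (s ∩ t) := by
  rw [Measure.real, cond_apply hs, ENNReal.toReal_mul, ENNReal.toReal_inv, Measure.real,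
    Measure.real]

theorem unifBall_compl_closedBall (d : ℕ) : unifBall d (Metric.closedBall 0 1)ᶜ = 0 := by
  rw [unifBall, cond_apply Metric.isClosed_closedBall.measurableSet, Set.inter_compl_self,
    measure_empty, mul_zero]

theorem unifBall_real_slab_le {d : ℕ} (hd : 1 ≤ d) {w : E d} (hw : ‖w‖ = 1) {t : ℝ} (ht : 0 ≤ t) :
    (unifBall d).real {x | margin w x < t} ≤ t * √(4 * d / Real.pi) := by
  obtain ⟨n, rfl⟩ := Nat.exists_eq_add_of_le' hd
  have hpos : 0 < (volume : Measure (E (n + 1))).real (Metric.closedBall 0 1) :=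
    ENNReal.toReal_pos (Metric.measure_closedBall_pos _ _ one_pos).ne' measure_closedBall_lt_top.ne
  have hslab : (volume : Measure (E (n + 1))).real
      (Metric.closedBall 0 1 ∩ {x | margin w x < t}) ≤
        2 * t * (volume : Measure (E n)).real (Metric.closedBall 0 1) := by
    have h := ENNReal.toReal_mono (ENNReal.mul_ne_top ENNReal.ofReal_ne_top
      measure_closedBall_lt_top.ne) (volume_closedBall_inter_slab_le hw t)
    rwa [ENNReal.toReal_mul, ENNReal.toReal_ofReal (by positivity)] at h
  have hsqrt : √(4 * (n + 1 : ℕ) / Real.pi) = 2 * √((n + 1 : ℕ) / Real.pi) := by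
    rw [mul_div_assoc, Real.sqrt_mul (by norm_num), show (4 : ℝ) = 2 ^ 2 by norm_num,
      Real.sqrt_sq (by norm_num)]
  rw [unifBall, real_cond_apply Metric.isClosed_closedBall.measurableSet, inv_mul_le_iff₀ hpos,
    hsqrt]
  calc _ ≤ 2 * t * (volume : Measure (E n)).real (Metric.closedBall 0 1) := hslab
    _ ≤ 2 * t * (√((n + 1 : ℕ) / Real.pi) *
        (volume : Measure (E (n + 1))).real (Metric.closedBall 0 1)) := by
        gcongr
        exact volume_real_closedBall_le_succ n
    _ = _ := by ring

end UnitBall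

section Indicators

variable {d : ℕ}

/-- The classifiers and thresholds of all rounds. -/
abbrev RunParams (d : ℕ) : Type := (ℕ → E d) × (ℕ → EReal)

open scoped Classical in
/-- Indicator of the points on which all rounds before round `i` abstain. -/
noncomputable def undecided (i : ℕ) (θ : RunParams d) (y : E d) : ℝ :=
  if ∀ l < i, ¬ Accepts (θ.1 l) (θ.2 l) y then 1 else 0

open scoped Classical in
/-- Indicator of the points `y` that are auto-labeled in round `i`, with a label `s` such that
`R s y`. -/
noncomputable def labeledAt (R : SignType → E d → Prop) (i : ℕ) (θ : RunParams d) (y : E d) : ℝ :=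
  if (∀ l < i, ¬ Accepts (θ.1 l) (θ.2 l) y) ∧ Accepts (θ.1 i) (θ.2 i) y ∧
    R (linClassifier (θ.1 i) y) y then 1 else 0

/-- Indicator of the points that get a wrong label in round `i`. -/
noncomputable abbrev wrongAt (f : E d → SignType) : ℕ → RunParams d → E d → ℝ :=
  labeledAt fun s y => s ≠ f y

/-- Indicator of the points that get the right label in round `i`. -/
noncomputable abbrev rightAt (f : E d → SignType) : ℕ → RunParams d → E d → ℝ :=
  labeledAt fun s y => s = f y

/-- The wrong labels of the rounds in `S` minus the right labels of the other rounds before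
round `k`. -/
noncomputable def mixture (f : E d → SignType) (k : ℕ) (S : Finset ℕ) (θ : RunParams d)
    (y : E d) : ℝ :=
  ∑ i ∈ Finset.range k, if i ∈ S then wrongAt f i θ y else -rightAt f i θ y

theorem undecided_mem (i : ℕ) (θ : RunParams d) (y : E d) :
    undecided i θ y ∈ ({0, 1} : Set ℝ) := by
  unfold undecided
  split_ifs <;> simp

theorem labeledAt_mem (R : SignType → E d → Prop) (i : ℕ) (θ : RunParams d) (y : E d) :
    labeledAt R i θ y ∈ ({0, 1} : Set ℝ) := by
  unfold labeledAt
  split_ifs <;> simp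

theorem undecided_nonneg (i : ℕ) (θ : RunParams d) (y : E d) : 0 ≤ undecided i θ y := by
  unfold undecided
  split_ifs <;> norm_num

theorem labeledAt_nonneg (R : SignType → E d → Prop) (i : ℕ) (θ : RunParams d) (y : E d) :
    0 ≤ labeledAt R i θ y := by
  unfold labeledAt
  split_ifs <;> norm_num

theorem wrongAt_add_rightAt (f : E d → SignType) (i : ℕ) (θ : RunParams d) (y : E d) :
    wrongAt f i θ y + rightAt f i θ y = undecided i θ y - undecided (i + 1) θ y := by
  have hsucc : (∀ l < i + 1, ¬ Accepts (θ.1 l) (θ.2 l) y) ↔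
      (∀ l < i, ¬ Accepts (θ.1 l) (θ.2 l) y) ∧ ¬ Accepts (θ.1 i) (θ.2 i) y :=
    Nat.forall_lt_succ_right
  unfold wrongAt rightAt labeledAt undecided
  grind

theorem sum_wrongAt_add_rightAt (f : E d → SignType) (k : ℕ) (θ : RunParams d) (y : E d) :
    ∑ i ∈ Finset.range k, (wrongAt f i θ y + rightAt f i θ y) = 1 - undecided k θ y := by
  simp only [wrongAt_add_rightAt, Finset.sum_range_sub', sub_left_inj]
  simp [undecided]

theorem abs_mixture_le_one (f : E d → SignType) (k : ℕ) (S : Finset ℕ) (θ : RunParams d)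
    (y : E d) : |mixture f k S θ y| ≤ 1 := by
  calc |mixture f k S θ y|
      ≤ ∑ i ∈ Finset.range k, |if i ∈ S then wrongAt f i θ y else -rightAt f i θ y| :=
        Finset.abs_sum_le_sum_abs _ _
    _ ≤ ∑ i ∈ Finset.range k, (wrongAt f i θ y + rightAt f i θ y) := by
        refine Finset.sum_le_sum fun i _ => ?_
        have hwrong := labeledAt_nonneg (fun s y => s ≠ f y) i θ y
        have hright := labeledAt_nonneg (fun s y => s = f y) i θ y
        split_ifs
        · rwa [abs_of_nonneg hwrong, le_add_iff_nonneg_right]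
        · rwa [abs_neg, abs_of_nonneg hright, le_add_iff_nonneg_left]
    _ ≤ 1 := by
        rw [sum_wrongAt_add_rightAt]
        exact sub_le_self 1 (undecided_nonneg k θ y)

end Indicators

section IndicatorMeasurability

variable {d : ℕ}

theorem measurable_inner_round (l : ℕ) :
    Measurable fun q : RunParams d × E d => (inner ℝ (q.1.1 l) q.2 : ℝ) :=
  ((measurable_pi_apply l).comp (measurable_fst.comp measurable_fst)).inner measurable_snd

theorem measurableSet_accepts_round (l : ℕ) :
    MeasurableSet {q : RunParams d × E d | Accepts (q.1.1 l) (q.1.2 l) q.2} :=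
  measurableSet_le ((measurable_pi_apply l).comp (measurable_snd.comp measurable_fst))
    (measurable_inner_round l).abs.coe_real_ereal

theorem measurableSet_linClassifier_round (l : ℕ) (s : SignType) :
    MeasurableSet {q : RunParams d × E d | linClassifier (q.1.1 l) q.2 = s} := by
  have hinner := measurable_inner_round (d := d) l
  cases s
  · simpa only [linClassifier, SignType.zero_eq_zero, sign_eq_zero_iff] using
      measurableSet_eq_fun hinner measurable_const
  · simpa only [linClassifier, SignType.neg_eq_neg_one, sign_eq_neg_one_iff] using
      measurableSet_lt hinner measurable_const
  · simpa only [linClassifier, SignType.pos_eq_one, sign_eq_one_iff] using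
      measurableSet_lt measurable_const hinner

theorem measurableSet_forall_not_accepts (i : ℕ) :
    MeasurableSet {q : RunParams d × E d | ∀ l < i, ¬ Accepts (q.1.1 l) (q.1.2 l) q.2} := by
  simp only [Set.ofPred_forall]
  exact .iInter fun l => .iInter fun _ => (measurableSet_accepts_round l).compl

theorem measurable_undecided (i : ℕ) :
    Measurable (Function.uncurry (undecided (d := d) i)) :=
  Measurable.ite (measurableSet_forall_not_accepts i) measurable_const measurable_const

theorem measurable_labeledAt {R : SignType → E d → Prop} (hR : ∀ s, MeasurableSet {y | R s y})
    (i : ℕ) : Measurable (Function.uncurry (labeledAt R i)) := by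
  have hlabel : MeasurableSet {q : RunParams d × E d | R (linClassifier (q.1.1 i) q.2) q.2} := by
    have heq : {q : RunParams d × E d | R (linClassifier (q.1.1 i) q.2) q.2} =
        ⋃ s, {q | linClassifier (q.1.1 i) q.2 = s} ∩ Prod.snd ⁻¹' {y | R s y} := by
      ext q
      simp
    rw [heq]
    exact .iUnion fun s => (measurableSet_linClassifier_round i s).inter (measurable_snd (hR s))
  exact Measurable.ite ((measurableSet_forall_not_accepts i).inter
    ((measurableSet_accepts_round i).inter hlabel)) measurable_const measurable_const

variable {f : E d → SignType}

theorem measurable_wrongAt (hf : ∀ s, MeasurableSet (f ⁻¹' {s})) (i : ℕ) :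
    Measurable (Function.uncurry (wrongAt f i)) := by
  refine measurable_labeledAt (fun s => ?_) i
  simpa only [Set.preimage, Set.mem_singleton_iff, eq_comm] using! (hf s).compl

theorem measurable_rightAt (hf : ∀ s, MeasurableSet (f ⁻¹' {s})) (i : ℕ) :
    Measurable (Function.uncurry (rightAt f i)) := by
  refine measurable_labeledAt (fun s => ?_) i
  simpa only [Set.preimage, Set.mem_singleton_iff, eq_comm] using! hf s

theorem measurable_mixture (hf : ∀ s, MeasurableSet (f ⁻¹' {s})) (k : ℕ) (S : Finset ℕ) :
    Measurable (Function.uncurry (mixture f k S)) := by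
  unfold Function.uncurry mixture
  refine Finset.measurable_sum (f := fun i (q : RunParams d × E d) =>
    if i ∈ S then wrongAt f i q.1 q.2 else -rightAt f i q.1 q.2) _ fun i _ => ?_
  split_ifs
  exacts [measurable_wrongAt hf i, (measurable_rightAt hf i).neg]

end IndicatorMeasurability

section IndicatorGrowth

variable {d : ℕ}

theorem decision_eq_none_iff {p : E d × EReal} {y : E d} :
    decision p y = none ↔ ¬ Accepts p.1 p.2 y := by
  simp [decision]

theorem decision_eq_some_iff {p : E d × EReal} {y : E d} {s : SignType} :
    decision p y = some s ↔ Accepts p.1 p.2 y ∧ linClassifier p.1 y = s := by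
  simp [decision]

/-- The decision of round `l`. -/
noncomputable abbrev decisionAt (l : ℕ) (θ : RunParams d) (y : E d) : Option SignType :=
  decision (θ.1 l, θ.2 l) y

theorem undecided_congr {i : ℕ} {θ θ' : RunParams d} {y : E d}
    (h : ∀ l < i, decisionAt l θ y = decisionAt l θ' y) : undecided i θ y = undecided i θ' y := by
  have hiff : (∀ l < i, ¬ Accepts (θ.1 l) (θ.2 l) y) ↔ ∀ l < i, ¬ Accepts (θ'.1 l) (θ'.2 l) y :=
    forall₂_congr fun l hl => by
      simpa only [decisionAt, decision_eq_none_iff] using Iff.of_eq (congrArg (· = none) (h l hl))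
  classical
  exact if_congr hiff rfl rfl

theorem labeledAt_congr {R : SignType → E d → Prop} {i : ℕ} {θ θ' : RunParams d} {y : E d}
    (h : ∀ l < i + 1, decisionAt l θ y = decisionAt l θ' y) :
    labeledAt R i θ y = labeledAt R i θ' y := by
  have hlabel (θ : RunParams d) : Accepts (θ.1 i) (θ.2 i) y ∧ R (linClassifier (θ.1 i) y) y ↔
      ∃ s, decisionAt i θ y = some s ∧ R s y := by
    simp [decisionAt, decision_eq_some_iff, and_assoc]
  have hiff : (∀ l < i, ¬ Accepts (θ.1 l) (θ.2 l) y) ↔ ∀ l < i, ¬ Accepts (θ'.1 l) (θ'.2 l) y :=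
    forall₂_congr fun l hl => by
      simpa only [decisionAt, decision_eq_none_iff] using
        Iff.of_eq (congrArg (· = none) (h l (by omega)))
  classical
  refine if_congr (and_congr hiff ?_) rfl rfl
  rw [hlabel, hlabel, h i i.lt_succ_self]

theorem mixture_congr {f : E d → SignType} {k : ℕ} {S : Finset ℕ} {θ θ' : RunParams d} {y : E d}
    (h : ∀ l < k, decisionAt l θ y = decisionAt l θ' y) :
    mixture f k S θ y = mixture f k S θ' y := by
  refine Finset.sum_congr rfl fun i hi => ?_
  have hi' : ∀ l < i + 1, decisionAt l θ y = decisionAt l θ' y :=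
    fun l hl => h l (by have := Finset.mem_range.1 hi; omega)
  simp only [wrongAt, rightAt, labeledAt_congr hi']

theorem growthLE_of_decisionAt {β : Type*} {φ : RunParams d → E d → β} {r : ℕ} (n : ℕ)
    (hφ : ∀ θ θ' y, (∀ l < r, decisionAt l θ y = decisionAt l θ' y) → φ θ y = φ θ' y) :
    GrowthLE φ (2 * n) (roundGrowth d n ^ r) :=
  (growthLE_decision d (2 * n)).pow (fun l : Fin r => fun θ => (θ.1 l, θ.2 l))
    fun θ θ' y h => hφ θ θ' y fun l hl => h ⟨l, hl⟩

end IndicatorGrowth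

section SampleMeans

variable {d n : ℕ} (f : E d → SignType) (z : Fin n → E d) (W : ℕ → E d) (T : ℕ → EReal)

theorem sampleMean_nonneg {𝒳 : Type*} (z : Fin n → 𝒳) {g : 𝒳 → ℝ} (hg : ∀ y, 0 ≤ g y) :
    0 ≤ sampleMean z g :=
  div_nonneg (Finset.sum_nonneg fun _ _ => hg _) n.cast_nonneg

theorem natCast_mul_sampleMean {𝒳 : Type*} (z : Fin n → 𝒳) (g : 𝒳 → ℝ) :
    n * sampleMean z g = ∑ j, g (z j) := by
  rcases Nat.eq_zero_or_pos n with rfl | hn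
  · simp [sampleMean]
  · exact mul_div_cancel₀ _ (by positivity)

theorem sampleMean_wrongAt_add_sampleMean_rightAt (i : ℕ) (θ : RunParams d) :
    sampleMean z (wrongAt f i θ) + sampleMean z (rightAt f i θ) =
      sampleMean z (undecided i θ) - sampleMean z (undecided (i + 1) θ) := by
  simp only [sampleMean, ← add_div, ← sub_div, ← Finset.sum_add_distrib, ← Finset.sum_sub_distrib,
    wrongAt_add_rightAt]

theorem sum_sampleMean_wrongAt_add_sampleMean_rightAt (hn : 0 < n) (k : ℕ) (θ : RunParams d) :
    ∑ i ∈ Finset.range k, (sampleMean z (wrongAt f i θ) + sampleMean z (rightAt f i θ)) =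
      1 - sampleMean z (undecided k θ) := by
  simp only [sampleMean_wrongAt_add_sampleMean_rightAt, Finset.sum_range_sub', sub_left_inj]
  simp [sampleMean, undecided, hn.ne']

theorem sampleMean_mixture (k : ℕ) (S : Finset ℕ) (θ : RunParams d) :
    sampleMean z (mixture f k S θ) = ∑ i ∈ Finset.range k,
      if i ∈ S then sampleMean z (wrongAt f i θ) else -sampleMean z (rightAt f i θ) := by
  simp only [sampleMean, mixture]
  rw [Finset.sum_comm, Finset.sum_div]
  refine Finset.sum_congr rfl fun i _ => ?_
  split_ifs
  · rfl
  · rw [Finset.sum_neg_distrib, neg_div]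

theorem sum_loss01_accepted_eq (i : ℕ) :
    ∑ m ∈ accepted z (remaining z W T i) (W i) (T i), loss01 f (W i) (z m) =
      n * sampleMean z (wrongAt f i (W, T)) := by
  classical
  rw [natCast_mul_sampleMean, accepted, remaining, Finset.filter_filter, Finset.sum_filter]
  refine Finset.sum_congr rfl fun m _ => ?_
  unfold loss01 wrongAt labeledAt
  grind

theorem card_accepted_eq (i : ℕ) :
    ((accepted z (remaining z W T i) (W i) (T i)).card : ℝ) =
      n * (sampleMean z (wrongAt f i (W, T)) + sampleMean z (rightAt f i (W, T))) := by
  classical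
  rw [mul_add, natCast_mul_sampleMean, natCast_mul_sampleMean, ← Finset.sum_add_distrib, accepted,
    remaining, Finset.filter_filter, Finset.card_filter, Nat.cast_sum]
  refine Finset.sum_congr rfl fun m _ => ?_
  rw [Nat.cast_ite, Nat.cast_one, Nat.cast_zero]
  unfold wrongAt rightAt labeledAt
  grind

theorem empCondErr_eq (i : ℕ) :
    empCondErr f z (remaining z W T i) (W i) (T i) =
      sampleMean z (wrongAt f i (W, T)) /
        (sampleMean z (wrongAt f i (W, T)) + sampleMean z (rightAt f i (W, T))) := by
  rw [empCondErr, sum_loss01_accepted_eq, card_accepted_eq f]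
  rcases Nat.eq_zero_or_pos n with rfl | hn
  · simp [sampleMean]
  · exact mul_div_mul_left _ _ (by positivity)

end SampleMeans

section AutoLabeled

variable {d N : ℕ} (f : E d → SignType) (X : Fin N → E d) (W : ℕ → E d) (T : ℕ → EReal) (k : ℕ)

theorem pairwise_disjoint_autoRound : Pairwise fun i j =>
    Disjoint (autoRound X W T i) (autoRound X W T j) := by
  classical
  refine (pairwise_disjoint_on _).2 fun i j hij => Finset.disjoint_left.2 fun m hi hj => ?_
  exact (Finset.mem_filter.1 (Finset.mem_filter.1 hj).1).2 i hij (Finset.mem_filter.1 hi).2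

theorem card_autoLabeled :
    (autoLabeled X W T k).card = ∑ i ∈ Finset.range k, (autoRound X W T i).card :=
  Finset.card_biUnion fun _ _ _ _ hij => pairwise_disjoint_autoRound X W T hij

theorem cast_card_autoLabeled_eq :
    ((autoLabeled X W T k).card : ℝ) = N * ∑ i ∈ Finset.range k,
      (sampleMean X (wrongAt f i (W, T)) + sampleMean X (rightAt f i (W, T))) := by
  simp only [card_autoLabeled, Nat.cast_sum, autoRound, card_accepted_eq f, Finset.mul_sum]

variable {X W T} in
theorem autoLabel_eq_of_mem_autoRound {i : ℕ} {m : Fin N} (hm : m ∈ autoRound X W T i) :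
    autoLabel W T (X m) = linClassifier (W i) (X m) := by
  classical
  obtain ⟨hrem, hacc⟩ := Finset.mem_filter.1 hm
  have hfirst : sInf {j | Accepts (W j) (T j) (X m)} = i :=
    IsLeast.csInf_eq ⟨hacc, fun j hj => not_lt.1 fun hlt => (Finset.mem_filter.1 hrem).2 j hlt hj⟩
  rw [autoLabel, hfirst]

theorem autoErr_eq :
    autoErr f X W T k = (∑ i ∈ Finset.range k, sampleMean X (wrongAt f i (W, T))) /
      ∑ i ∈ Finset.range k,
        (sampleMean X (wrongAt f i (W, T)) + sampleMean X (rightAt f i (W, T))) := by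
  classical
  have hwrong : ∑ m ∈ autoLabeled X W T k,
      (if autoLabel W T (X m) ≠ f (X m) then (1 : ℝ) else 0) =
        N * ∑ i ∈ Finset.range k, sampleMean X (wrongAt f i (W, T)) := by
    rw [autoLabeled, Finset.sum_biUnion fun _ _ _ _ hij => pairwise_disjoint_autoRound X W T hij,
      Finset.mul_sum]
    refine Finset.sum_congr rfl fun i _ => ?_
    rw [← sum_loss01_accepted_eq]
    refine Finset.sum_congr rfl fun m hm => ?_
    rw [autoLabel_eq_of_mem_autoRound hm, loss01]
  unfold autoErr
  rw [cast_card_autoLabeled_eq f]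
  rcases Nat.eq_zero_or_pos N with rfl | hN
  · simp [sampleMean]
  · exact (congrArg (· / _) hwrong).trans (mul_div_mul_left _ _ (by positivity))

theorem autoErr_le_one : autoErr f X W T k ≤ 1 := by
  rw [autoErr_eq]
  have hwrong (i : ℕ) : 0 ≤ sampleMean X (wrongAt f i (W, T)) :=
    sampleMean_nonneg X (labeledAt_nonneg _ i _)
  have hright (i : ℕ) : 0 ≤ sampleMean X (rightAt f i (W, T)) :=
    sampleMean_nonneg X (labeledAt_nonneg _ i _)
  exact div_le_one_of_le₀
    (Finset.sum_le_sum fun i _ => le_add_of_nonneg_right (hright i))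
    (Finset.sum_nonneg fun i _ => add_nonneg (hwrong i) (hright i))

theorem coverage_eq (hN : 0 < N) :
    coverage X W T k = 1 - sampleMean X (undecided k (W, T)) := by
  rw [coverage, cast_card_autoLabeled_eq fun _ => 0, mul_div_cancel_left₀ _ (by positivity),
    sum_sampleMean_wrongAt_add_sampleMean_rightAt _ X hN]

end AutoLabeled

section LeftProbability

variable {d : ℕ} {f : E d → SignType}

/-- The probability that all rounds before round `i` abstain. -/
noncomputable def leftProb (θ : RunParams d) (i : ℕ) : ℝ := ∫ y, undecided i θ y ∂(unifBall d)

theorem integrable_of_mem_zero_one {φ : RunParams d → E d → ℝ}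
    (hφ : Measurable (Function.uncurry φ)) (hV : ∀ θ y, φ θ y ∈ ({0, 1} : Set ℝ))
    (θ : RunParams d) : Integrable (φ θ) (unifBall d) := by
  refine .of_bound (hφ.comp measurable_prodMk_left).aestronglyMeasurable 1 (.of_forall fun y => ?_)
  rcases hV θ y with h | (h : _ = 1) <;> simp [h]

theorem integrable_undecided (θ : RunParams d) (i : ℕ) :
    Integrable (undecided i θ) (unifBall d) :=
  integrable_of_mem_zero_one (measurable_undecided i) (undecided_mem i) θ

theorem integrable_wrongAt (hf : ∀ s, MeasurableSet (f ⁻¹' {s})) (θ : RunParams d) (i : ℕ) :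
    Integrable (wrongAt f i θ) (unifBall d) :=
  integrable_of_mem_zero_one (measurable_wrongAt hf i) (labeledAt_mem _ i) θ

theorem integrable_rightAt (hf : ∀ s, MeasurableSet (f ⁻¹' {s})) (θ : RunParams d) (i : ℕ) :
    Integrable (rightAt f i θ) (unifBall d) :=
  integrable_of_mem_zero_one (measurable_rightAt hf i) (labeledAt_mem _ i) θ

theorem leftProb_zero (θ : RunParams d) : leftProb θ 0 = 1 := by
  simp [leftProb, undecided]

theorem leftProb_nonneg (θ : RunParams d) (i : ℕ) : 0 ≤ leftProb θ i :=
  integral_nonneg (undecided_nonneg i θ)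

theorem integral_wrongAt_add_integral_rightAt (hf : ∀ s, MeasurableSet (f ⁻¹' {s}))
    (θ : RunParams d) (i : ℕ) :
    ∫ y, wrongAt f i θ y ∂(unifBall d) + ∫ y, rightAt f i θ y ∂(unifBall d) =
      leftProb θ i - leftProb θ (i + 1) := by
  rw [← integral_add (integrable_wrongAt hf θ i) (integrable_rightAt hf θ i), leftProb, leftProb,
    ← integral_sub (integrable_undecided θ i) (integrable_undecided θ (i + 1))]
  simp only [wrongAt_add_rightAt]

theorem integral_mixture (hf : ∀ s, MeasurableSet (f ⁻¹' {s})) (k : ℕ) (S : Finset ℕ)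
    (θ : RunParams d) :
    ∫ y, mixture f k S θ y ∂(unifBall d) = ∑ i ∈ Finset.range k,
      if i ∈ S then ∫ y, wrongAt f i θ y ∂(unifBall d)
      else -∫ y, rightAt f i θ y ∂(unifBall d) := by
  unfold mixture
  rw [integral_finsetSum]
  · refine Finset.sum_congr rfl fun i _ => ?_
    split_ifs
    · rfl
    · exact integral_neg _
  · intro i _
    split_ifs
    exacts [integrable_wrongAt hf θ i, (integrable_rightAt hf θ i).neg]

variable (W : ℕ → E d) (T : ℕ → EReal)

theorem measurableSet_forall_not_accepts_section (i : ℕ) :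
    MeasurableSet {y | ∀ l < i, ¬ Accepts (W l) (T l) y} :=
  measurable_prodMk_left (x := (W, T)) (measurableSet_forall_not_accepts i)

theorem leftProb_eq_real (i : ℕ) :
    leftProb (W, T) i = (unifBall d).real {y | ∀ l < i, ¬ Accepts (W l) (T l) y} := by
  classical
  rw [← integral_indicator_one (measurableSet_forall_not_accepts_section W T i), leftProb]
  refine integral_congr_ae (.of_forall fun y => ?_)
  simp only [undecided, Set.indicator_apply, Set.mem_ofPred_eq, Pi.one_apply]

theorem unifBall_real_closedBall_inter (A : Set (E d)) :
    (unifBall d).real (Metric.closedBall 0 1 ∩ A) = (unifBall d).real A := by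
  rw [Measure.real, Set.inter_comm, measure_inter_conull (unifBall_compl_closedBall d),
    Measure.real]

theorem acceptProb_region (i : ℕ) :
    acceptProb (W i) (T i) (region W T i) =
      (leftProb (W, T) i - leftProb (W, T) (i + 1)) / leftProb (W, T) i := by
  have hregion : region W T i =
      Metric.closedBall 0 1 ∩ {y | ∀ l < i, ¬ Accepts (W l) (T l) y} := rfl
  have hmeas := measurableSet_forall_not_accepts_section W T
  have hregion_meas : MeasurableSet (region W T i) :=
    Metric.isClosed_closedBall.measurableSet.inter (hmeas i)
  have hsucc (y : E d) : (∀ l < i + 1, ¬ Accepts (W l) (T l) y) ↔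
      (∀ l < i, ¬ Accepts (W l) (T l) y) ∧ ¬ Accepts (W i) (T i) y := Nat.forall_lt_succ_right
  have hsubset : {y | ∀ l < i + 1, ¬ Accepts (W l) (T l) y} ⊆
      {y | ∀ l < i, ¬ Accepts (W l) (T l) y} := fun y hy => ((hsucc y).1 hy).1
  have haccepted : region W T i ∩ {y | y ∈ region W T i ∧ Accepts (W i) (T i) y} =
      Metric.closedBall 0 1 ∩ ({y | ∀ l < i, ¬ Accepts (W l) (T l) y} \
        {y | ∀ l < i + 1, ¬ Accepts (W l) (T l) y}) := by
    ext y
    simp only [hregion, Set.mem_inter_iff, Set.mem_ofPred_eq, Set.mem_sdiff, hsucc]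
    tauto
  rw [acceptProb, real_cond_apply hregion_meas, haccepted, hregion,
    unifBall_real_closedBall_inter, unifBall_real_closedBall_inter,
    measureReal_sdiff hsubset (hmeas (i + 1)), leftProb_eq_real, leftProb_eq_real, inv_mul_eq_div]

variable {W T} in
theorem leftProb_pos_of_acceptProb_pos {i : ℕ}
    (h : 0 < acceptProb (W i) (T i) (region W T i)) : 0 < leftProb (W, T) i := by
  refine (leftProb_nonneg _ i).lt_of_ne fun h0 => ?_
  rw [acceptProb_region, ← h0, div_zero] at h
  exact h.false

variable {W T} in
theorem mul_leftProb_le_of_le_acceptProb {i : ℕ} {p₀ : ℝ} (hp : 0 < p₀)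
    (h : p₀ ≤ acceptProb (W i) (T i) (region W T i)) :
    p₀ * leftProb (W, T) i ≤ leftProb (W, T) i - leftProb (W, T) (i + 1) := by
  have hpos := leftProb_pos_of_acceptProb_pos (hp.trans_le h)
  rwa [acceptProb_region, le_div_iff₀ hpos] at h

theorem acceptProb_top (w : E d) (S : Set (E d)) : acceptProb w ⊤ S = 0 := by
  simp [acceptProb, Accepts]

end LeftProbability

section ComplexityTerm

variable {d k n : ℕ} {δ : ℝ}

theorem log_eight_mul_div_pos (hk : 1 ≤ k) (hδ : 0 < δ) (hδ1 : δ < 1) :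
    0 < Real.log (8 * (k : ℝ) / δ) := by
  have hk' : (1 : ℝ) ≤ k := by exact_mod_cast hk
  exact Real.log_pos ((one_lt_div hδ).2 (by linarith))

theorem one_le_log_exp_mul_div (hd : 1 ≤ d) (hn : d ≤ n) :
    1 ≤ Real.log (Real.exp 1 * (n : ℝ) / d) := by
  have hd0 : (0 : ℝ) < d := by exact_mod_cast hd
  have hdn : (d : ℝ) ≤ n := by exact_mod_cast hn
  have hn0 : (0 : ℝ) < n := hd0.trans_le hdn
  rw [Real.le_log_iff_exp_le (by positivity), le_div_iff₀ hd0]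
  gcongr

theorem two_mul_le_complexityTerm (hd : 1 ≤ d) (hn : d ≤ n) (hk : 1 ≤ k) (hδ : 0 < δ)
    (hδ1 : δ < 1) : 2 * (d : ℝ) ≤ complexityTerm d k δ n := by
  have hlog := mul_le_mul_of_nonneg_left (one_le_log_exp_mul_div hd hn)
    (by positivity : (0 : ℝ) ≤ 2 * d)
  rw [mul_one] at hlog
  exact hlog.trans (le_add_of_nonneg_right (log_eight_mul_div_pos hk hδ hδ1).le)

theorem complexityTerm_pos (hd : 1 ≤ d) (hn : d ≤ n) (hk : 1 ≤ k) (hδ : 0 < δ) (hδ1 : δ < 1) :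
    0 < complexityTerm d k δ n :=
  (by positivity : (0 : ℝ) < 2 * d).trans_le (two_mul_le_complexityTerm hd hn hk hδ hδ1)

theorem complexityTerm_div_anti (hd : 1 ≤ d) {a b : ℕ} (ha : d ≤ a) (hab : a ≤ b) (hk : 1 ≤ k)
    (hδ : 0 < δ) (hδ1 : δ < 1) : complexityTerm d k δ b / b ≤ complexityTerm d k δ a / a := by
  have : (0 : ℝ) < d := by exact_mod_cast hd
  have ha0 : (0 : ℝ) < a := by exact_mod_cast hd.trans ha
  have hab' : (a : ℝ) ≤ b := by exact_mod_cast hab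
  have hb0 : (0 : ℝ) < b := ha0.trans_le hab'
  have hloga := one_le_log_exp_mul_div hd ha
  have hlogb : Real.log (Real.exp 1 * (b : ℝ) / d) ≤
      Real.log (Real.exp 1 * (a : ℝ) / d) + (b / a - 1) := by
    have hsplit : Real.exp 1 * (b : ℝ) / d = Real.exp 1 * (a : ℝ) / d * (b / a) := by field_simp
    rw [hsplit, Real.log_mul (by positivity) (by positivity)]
    linarith [Real.log_le_sub_one_of_pos (show 0 < (b : ℝ) / a by positivity)]
  have hcross : a * Real.log (Real.exp 1 * (b : ℝ) / d) ≤
      b * Real.log (Real.exp 1 * (a : ℝ) / d) := by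
    calc a * Real.log (Real.exp 1 * (b : ℝ) / d)
        ≤ a * (Real.log (Real.exp 1 * (a : ℝ) / d) + (b / a - 1)) := by gcongr
      _ = a * Real.log (Real.exp 1 * (a : ℝ) / d) + (b - a) * 1 := by field_simp
      _ ≤ a * Real.log (Real.exp 1 * (a : ℝ) / d) +
          (b - a) * Real.log (Real.exp 1 * (a : ℝ) / d) := by
        gcongr
      _ = b * Real.log (Real.exp 1 * (a : ℝ) / d) := by ring
  have hconst := mul_le_mul_of_nonneg_left hab' (log_eight_mul_div_pos hk hδ hδ1).le
  rw [div_le_div_iff₀ hb0 ha0, complexityTerm, complexityTerm]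
  linear_combination 2 * (d : ℝ) * hcross + hconst

theorem sqrt_div_mul_complexityTerm_anti (hd : 1 ≤ d) {a b : ℕ} (ha : d ≤ a) (hab : a ≤ b)
    (hk : 1 ≤ k) (hδ : 0 < δ) (hδ1 : δ < 1) {c : ℝ} (hc : 0 ≤ c) :
    √(c / b * complexityTerm d k δ b) ≤ √(c / a * complexityTerm d k δ a) := by
  rw [div_mul_eq_mul_div, div_mul_eq_mul_div, mul_div_assoc, mul_div_assoc]
  exact Real.sqrt_le_sqrt
    (mul_le_mul_of_nonneg_left (complexityTerm_div_anti hd ha hab hk hδ hδ1) hc)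

theorem three_mul_roundGrowth_pow_mul_exp_neg_le (hd : 1 ≤ d) (hn : 16 * d ≤ n) (hk : 1 ≤ k)
    (hδ : 0 < δ) (hδ1 : δ < 1) {j : ℕ} (hj : 1 ≤ j) :
    (3 * (roundGrowth d n : ℝ)) ^ j * Real.exp (-(j * complexityTerm d k δ n)) ≤ δ / (8 * k) := by
  have hk' : (1 : ℝ) ≤ k := by exact_mod_cast hk
  have hexp : Real.exp (-complexityTerm d k δ n) =
      (Real.exp (2 * d * Real.log (Real.exp 1 * n / d)))⁻¹ * (δ / (8 * k)) := by
    rw [complexityTerm, neg_add, Real.exp_add, Real.exp_neg, Real.exp_neg,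
      Real.exp_log (by positivity), inv_div]
  calc (3 * (roundGrowth d n : ℝ)) ^ j * Real.exp (-(j * complexityTerm d k δ n))
      = (3 * (roundGrowth d n : ℝ) * Real.exp (-complexityTerm d k δ n)) ^ j := by
        rw [← mul_neg, Real.exp_nat_mul, ← mul_pow]
    _ ≤ (δ / (8 * k)) ^ j := by
        rw [hexp, ← mul_assoc, ← div_eq_mul_inv]
        gcongr
        exact mul_le_of_le_one_left (by positivity)
          (div_le_one_of_le₀ (three_mul_roundGrowth_le hd hn) (Real.exp_pos _).le)
    _ ≤ δ / (8 * k) :=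
        pow_le_of_le_one (by positivity) ((div_le_one (by positivity)).2 (by linarith)) (by omega)

theorem roundGrowth_pow_mul_exp_neg_le (hd : 1 ≤ d) (hn : 16 * d ≤ n) (hk : 1 ≤ k)
    (hδ : 0 < δ) (hδ1 : δ < 1) {j : ℕ} (hj : 1 ≤ j) :
    ((roundGrowth d n ^ j : ℕ) : ℝ) * Real.exp (-(j * complexityTerm d k δ n)) ≤ δ / (8 * k) := by
  refine le_trans ?_ (three_mul_roundGrowth_pow_mul_exp_neg_le hd hn hk hδ hδ1 hj)
  rw [Nat.cast_pow]
  gcongr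
  linarith [(roundGrowth d n).cast_nonneg (α := ℝ)]

theorem sixteen_mul_le_of_mul_sqrt_lt_one (hd : 1 ≤ d) (hn : d ≤ n) (hk : 1 ≤ k) (hδ : 0 < δ)
    (hδ1 : δ < 1) {p₀ c : ℝ} (hp : 0 < p₀) (hp1 : p₀ < 1) (hc : 2 ≤ c)
    (h : 4 / p₀ * √(c / n * complexityTerm d k δ n) < 1) : 16 * d ≤ n := by
  have hn0 : (0 : ℝ) < n := by exact_mod_cast hd.trans hn
  have hC := two_mul_le_complexityTerm hd hn hk hδ hδ1
  have hsqrt : 4 * √(c / n * complexityTerm d k δ n) < 1 := by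
    rw [div_mul_eq_mul_div, div_lt_one hp] at h
    exact h.trans hp1
  have hlt : c / n * complexityTerm d k δ n < (1 / 4) ^ 2 :=
    (Real.sqrt_lt' (by norm_num)).1 (by linarith)
  rw [div_mul_eq_mul_div, div_lt_iff₀ hn0] at hlt
  have hcC : 2 * (2 * (d : ℝ)) ≤ c * complexityTerm d k δ n := by gcongr
  have : (16 * d : ℝ) ≤ n := by linarith
  exact_mod_cast this

end ComplexityTerm

section RelativeDeviation

theorem error_sub_empirical_mul_le {a b a' b' l η : ℝ} (ha : 0 ≤ a) (hb : 0 ≤ b) (hab : 0 < a + b)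
    (ha' : 0 ≤ a') (hb' : 0 ≤ b') (hab' : 0 < a' + b') (hl : 0 ≤ l) (hη : 0 ≤ η)
    (hlower : a - a' ≤ l * a + η) (hupper : b' - b ≤ l * b' + η) :
    a - a' / (a' + b') * (a + b) ≤ l * (a + b) + η := by
  have hmix {y : ℝ} (hy : 0 ≤ y) (hy1 : y ≤ 1) :
      (1 - y) * (a - a') + y * (b' - b) ≤ l * max (a + b) (a' + b') + η := by
    have hmaxa : a ≤ max (a + b) (a' + b') := (le_add_of_nonneg_right hb).trans (le_max_left _ _)
    have hmaxb : b' ≤ max (a + b) (a' + b') := (le_add_of_nonneg_left ha').trans (le_max_right _ _)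
    calc (1 - y) * (a - a') + y * (b' - b)
        ≤ (1 - y) * (l * a + η) + y * (l * b' + η) := by gcongr
      _ = l * ((1 - y) * a + y * b') + η := by ring
      _ ≤ l * ((1 - y) * max (a + b) (a' + b') + y * max (a + b) (a' + b')) + η := by
        gcongr
      _ = l * max (a + b) (a' + b') + η := by ring
  rcases le_total (a' + b') (a + b) with h | h
  · have hle := hmix (y := a' / (a' + b')) (by positivity) (div_le_one_of_le₀ (by linarith) hab'.le)
    rw [max_eq_left h] at hle
    refine le_of_eq_of_le ?_ hle
    field_simp
    ring
  · have hle := hmix (y := a / (a + b)) (by positivity) (div_le_one_of_le₀ (by linarith) hab.le)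
    rw [max_eq_right h] at hle
    have hratio : (a + b) / (a' + b') ≤ 1 := div_le_one_of_le₀ h hab'.le
    calc a - a' / (a' + b') * (a + b)
        = (a + b) / (a' + b') * ((1 - a / (a + b)) * (a - a') + a / (a + b) * (b' - b)) := by
          field_simp
          ring
      _ ≤ (a + b) / (a' + b') * (l * (a' + b') + η) := by gcongr
      _ = l * (a + b) + (a + b) / (a' + b') * η := by field_simp
      _ ≤ l * (a + b) + η := by
          gcongr
          exact mul_le_of_le_one_left hη hratio

theorem sq_mul_sum_succ_mul_pow (q : ℝ) (k : ℕ) :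
    (1 - q) ^ 2 * ∑ i ∈ Finset.range k, ((i : ℝ) + 1) * q ^ i = 1 - q ^ k * (1 + k * (1 - q)) := by
  induction k with
  | zero => simp
  | succ k ih =>
    rw [Finset.sum_range_succ, mul_add, ih]
    push_cast
    ring

theorem sq_mul_sum_succ_mul_pow_le {q : ℝ} (hq0 : 0 ≤ q) (hq1 : q ≤ 1) (k : ℕ) :
    (1 - q ^ 2) ^ 2 * ∑ i ∈ Finset.range k, ((i : ℝ) + 1) * q ^ i ≤ 4 * (1 - q ^ k) := by
  have : 0 ≤ 1 - q := sub_nonneg.2 hq1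
  have hsq : (1 + q) ^ 2 ≤ 4 := by nlinarith
  have hdrop : 0 ≤ q ^ k * (k * (1 - q)) := by positivity
  calc (1 - q ^ 2) ^ 2 * ∑ i ∈ Finset.range k, ((i : ℝ) + 1) * q ^ i
      = (1 + q) ^ 2 * ((1 - q) ^ 2 * ∑ i ∈ Finset.range k, ((i : ℝ) + 1) * q ^ i) := by ring
    _ ≤ 4 * ((1 - q) ^ 2 * ∑ i ∈ Finset.range k, ((i : ℝ) + 1) * q ^ i) := by gcongr
    _ ≤ 4 * (1 - q ^ k) := by
        rw [sq_mul_sum_succ_mul_pow]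
        linarith

theorem le_pow_of_mul_le_sub_succ {r : ℕ → ℝ} {k : ℕ} {p : ℝ} (hp : p ≤ 1) (hr0 : r 0 = 1)
    (hstep : ∀ i < k, p * r i ≤ r i - r (i + 1)) : ∀ i ≤ k, r i ≤ (1 - p) ^ i := by
  intro i
  induction i with
  | zero => simp [hr0]
  | succ i ih =>
    intro hi
    calc r (i + 1) ≤ (1 - p) * r i := by linarith [hstep i hi]
      _ ≤ (1 - p) * (1 - p) ^ i := by gcongr; exact ih (by omega)
      _ = (1 - p) ^ (i + 1) := (pow_succ' _ _).symm

theorem sum_sub_succ_div_pow_le {r : ℕ → ℝ} {k : ℕ} {q : ℝ} (hq0 : 0 < q) (hr0 : r 0 = 1)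
    (hr : ∀ i, 0 ≤ r i) (hrk : r k ≤ 1) (hanti : ∀ i < k, r (i + 1) ≤ r i)
    (hrq : ∀ i < k, r i ≤ (q ^ i) ^ 2) :
    ∑ i ∈ Finset.range k, (r i - r (i + 1)) / q ^ i ≤ 2 * (1 - r k) := by
  have hterm : ∀ i ∈ Finset.range k, (r i - r (i + 1)) / q ^ i ≤ 2 * (√(r i) - √(r (i + 1))) := by
    intro i hi
    have hik := Finset.mem_range.1 hi
    have hsqrt : √(r i) ≤ q ^ i := Real.sqrt_le_iff.2 ⟨by positivity, hrq i hik⟩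
    have hmono : √(r (i + 1)) ≤ √(r i) := Real.sqrt_le_sqrt (hanti i hik)
    have : 0 ≤ √(r i) - √(r (i + 1)) := sub_nonneg.2 hmono
    rw [div_le_iff₀ (by positivity)]
    calc r i - r (i + 1)
        = (√(r i) - √(r (i + 1))) * (√(r i) + √(r (i + 1))) := by
          rw [← Real.sq_sqrt (hr i), ← Real.sq_sqrt (hr (i + 1)), Real.sqrt_sq (Real.sqrt_nonneg _),
            Real.sqrt_sq (Real.sqrt_nonneg _)]
          ring
      _ ≤ (√(r i) - √(r (i + 1))) * (q ^ i + q ^ i) := by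
          gcongr
          exact hmono.trans hsqrt
      _ = 2 * (√(r i) - √(r (i + 1))) * q ^ i := by ring
  calc ∑ i ∈ Finset.range k, (r i - r (i + 1)) / q ^ i
      ≤ ∑ i ∈ Finset.range k, 2 * (√(r i) - √(r (i + 1))) := Finset.sum_le_sum hterm
    _ = 2 * (1 - √(r k)) := by
        rw [← Finset.mul_sum, Finset.sum_range_sub' (fun i => √(r i)), hr0, Real.sqrt_one]
    _ ≤ 2 * (1 - r k) := by
        gcongr
        exact Real.le_sqrt_of_sq_le (pow_le_of_le_one (hr k) hrk two_ne_zero)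

/-- The relative slack allowed in round `i` for the validation deviations. It grows
geometrically because round `i` only sees the points left by the earlier rounds, whose probability
is at most `(1 - p₀) ^ i`. -/
noncomputable def roundScale (p₀ C m : ℝ) (i : ℕ) : ℝ := √2 * (√(C / m) / p₀) / √(1 - p₀) ^ i

theorem roundScale_pos {p₀ C m : ℝ} (hp : 0 < p₀) (hp1 : p₀ < 1) (hC : 0 < C) (hm : 0 < m)
    (i : ℕ) : 0 < roundScale p₀ C m i := by
  have : 0 < √(1 - p₀) := Real.sqrt_pos.2 (sub_pos.2 hp1)
  unfold roundScale
  positivity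

theorem sum_roundScale_eq {r : ℕ → ℝ} {k : ℕ} {p₀ C m : ℝ} (hp : 0 < p₀) (hp1 : p₀ < 1)
    (hC : 0 < C) (hm : 0 < m) :
    ∑ i ∈ Finset.range k, (roundScale p₀ C m i * (r i - r (i + 1)) +
        (i + 1) * C / (m * roundScale p₀ C m i)) =
      √2 * (√(C / m) / p₀) * ∑ i ∈ Finset.range k, (r i - r (i + 1)) / √(1 - p₀) ^ i +
        √(C / m) * p₀ / √2 * ∑ i ∈ Finset.range k, ((i : ℝ) + 1) * √(1 - p₀) ^ i := by
  have hq : 0 < √(1 - p₀) := Real.sqrt_pos.2 (sub_pos.2 hp1)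
  rw [Finset.mul_sum, Finset.mul_sum, ← Finset.sum_add_distrib]
  refine Finset.sum_congr rfl fun i _ => ?_
  have hCm : C = √(C / m) ^ 2 * m := by
    rw [Real.sq_sqrt (by positivity), div_mul_cancel₀ _ hm.ne']
  have hinv : (i + 1) * C / (m * roundScale p₀ C m i) =
      √(C / m) * p₀ / √2 * ((i + 1) * √(1 - p₀) ^ i) := by
    have hs : 0 < √(C / m) := Real.sqrt_pos.2 (by positivity)
    unfold roundScale
    generalize √(C / m) = s at hCm hs
    rw [hCm]
    field_simp
  rw [hinv, roundScale]
  ring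

theorem sum_roundScale_le {r : ℕ → ℝ} {k : ℕ} {p₀ C m : ℝ} (hp : 0 < p₀) (hp1 : p₀ < 1)
    (hC : 0 < C) (hm : 0 < m) (hr0 : r 0 = 1) (hr : ∀ i, 0 ≤ r i)
    (hstep : ∀ i < k, p₀ * r i ≤ r i - r (i + 1)) :
    ∑ i ∈ Finset.range k, (roundScale p₀ C m i * (r i - r (i + 1)) +
        (i + 1) * C / (m * roundScale p₀ C m i)) ≤
      (1 - r k) * (4 / p₀ * √(2 / m * C)) := by
  have hq0 : 0 < √(1 - p₀) := Real.sqrt_pos.2 (sub_pos.2 hp1)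
  have hq1 : √(1 - p₀) ≤ 1 := Real.sqrt_le_one.2 (by linarith)
  have hq2 : √(1 - p₀) ^ 2 = 1 - p₀ := Real.sq_sqrt (by linarith)
  have hrq : ∀ i ≤ k, r i ≤ (√(1 - p₀) ^ i) ^ 2 := fun i hi => by
    rw [pow_right_comm, hq2]
    exact le_pow_of_mul_le_sub_succ hp1.le hr0 hstep i hi
  have hqk : √(1 - p₀) ^ k ≤ 1 := pow_le_one₀ hq0.le hq1
  have hrqk : r k ≤ √(1 - p₀) ^ k :=
    (hrq k le_rfl).trans (pow_le_of_le_one (by positivity) hqk two_ne_zero)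
  have hanti : ∀ i < k, r (i + 1) ≤ r i := fun i hi =>
    sub_nonneg.1 ((mul_nonneg hp.le (hr i)).trans (hstep i hi))
  have hfirst := sum_sub_succ_div_pow_le hq0 hr0 hr (hrqk.trans hqk) hanti fun i hi => hrq i hi.le
  have hsecond : ∑ i ∈ Finset.range k, ((i : ℝ) + 1) * √(1 - p₀) ^ i ≤ 4 * (1 - r k) / p₀ ^ 2 := by
    rw [le_div_iff₀' (by positivity)]
    have hsum := sq_mul_sum_succ_mul_pow_le hq0.le hq1 k
    rw [hq2, sub_sub_cancel] at hsum
    linarith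
  rw [sum_roundScale_eq hp hp1 hC hm]
  calc √2 * (√(C / m) / p₀) * ∑ i ∈ Finset.range k, (r i - r (i + 1)) / √(1 - p₀) ^ i +
        √(C / m) * p₀ / √2 * ∑ i ∈ Finset.range k, ((i : ℝ) + 1) * √(1 - p₀) ^ i
      ≤ √2 * (√(C / m) / p₀) * (2 * (1 - r k)) +
        √(C / m) * p₀ / √2 * (4 * (1 - r k) / p₀ ^ 2) := by gcongr
    _ = (1 - r k) * (√(C / m) / p₀) * (2 * √2 + 4 / √2) := by field_simp
    _ = (1 - r k) * (4 / p₀ * √(2 / m * C)) := by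
        have hfour : 4 / √2 = 2 * √2 := by
          rw [div_eq_iff (by positivity), mul_assoc, Real.mul_self_sqrt (by norm_num)]
          norm_num
        have hsplit : √(2 / m * C) = √2 * √(C / m) := by
          rw [← Real.sqrt_mul (by norm_num)]
          congr 1
          ring
        rw [hfour, hsplit]
        ring

end RelativeDeviation

section SmallDeviations

variable {d k N M : ℕ} {δ p₀ : ℝ} {f : E d → SignType}

/-- The sample `V` (validation) and the sample `X` (pool) represent the uniform distribution well
for the classifiers and thresholds `θ`: on `V` the wrong labels of each round have relative
deviations at most `roundScale`, and so have the right labels in the other direction, while on `X`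
the points left after all rounds and all mixtures of rounds have small absolute deviations. -/
structure SmallDeviations (f : E d → SignType) (X : Fin N → E d) (V : Fin M → E d)
    (θ : RunParams d) (k : ℕ) (δ p₀ : ℝ) : Prop where
  wrong_lt : ∀ i < k, ∫ y, wrongAt f i θ y ∂(unifBall d) - sampleMean V (wrongAt f i θ) <
    roundScale p₀ (complexityTerm d k δ M) M i * ∫ y, wrongAt f i θ y ∂(unifBall d) +
      (i + 1) * complexityTerm d k δ M / (M * roundScale p₀ (complexityTerm d k δ M) M i)
  right_lt : ∀ i < k, sampleMean V (rightAt f i θ) - ∫ y, rightAt f i θ y ∂(unifBall d) <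
    roundScale p₀ (complexityTerm d k δ M) M i * sampleMean V (rightAt f i θ) +
      (i + 1) * complexityTerm d k δ M / (M * roundScale p₀ (complexityTerm d k δ M) M i)
  mixture_lt : ∀ S ⊆ Finset.range k,
    sampleMean X (mixture f k S θ) - ∫ y, mixture f k S θ y ∂(unifBall d) <
      √(8 * (k * complexityTerm d k δ N) / N)
  undecided_lt : sampleMean X (undecided k θ) - leftProb θ k <
    √(8 * (k * complexityTerm d k δ N) / N)

theorem measureReal_exists_lt_le {Ω : Type*} [MeasurableSpace Ω] {μ : Measure Ω} {A : ℕ → Ω → Prop}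
    {c : ℝ} (h : ∀ i, μ.real {ω | A i ω} ≤ c) (k : ℕ) :
    μ.real {ω | ∃ i < k, A i ω} ≤ k * c := by
  have hunion : {ω | ∃ i < k, A i ω} = ⋃ i ∈ Finset.range k, {ω | A i ω} := by
    ext ω
    simp
  rw [hunion]
  refine (measureReal_biUnion_finset_le _ _).trans
    ((Finset.sum_le_card_nsmul _ _ c fun i _ => h i).trans_eq ?_)
  simp

variable {Ω : Type*} [MeasurableSpace Ω] {μ : Measure Ω} [IsProbabilityMeasure μ]
  {X : Ω → Fin N → E d} {V : Ω → Fin M → E d} {θ : Ω → RunParams d}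

theorem measure_wrongAt_deviation_le (hd : 1 ≤ d) (hk : 1 ≤ k) (hδ : 0 < δ) (hδ1 : δ < 1)
    (hM : 16 * d ≤ M) (hf : ∀ s, MeasurableSet (f ⁻¹' {s})) (hV : Measurable V)
    (hlaw : μ.map V = Measure.pi fun _ => unifBall d) (hθ : Measurable θ) (i : ℕ) {l : ℝ}
    (hl : 0 < l) :
    μ.real {ω | l * ∫ y, wrongAt f i (θ ω) y ∂(unifBall d) +
        (i + 1) * complexityTerm d k δ M / (M * l) ≤
      ∫ y, wrongAt f i (θ ω) y ∂(unifBall d) - sampleMean (V ω) (wrongAt f i (θ ω))} ≤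
      δ / (8 * k) := by
  have := isProbabilityMeasure_unifBall d
  have hdev := measure_lower_relative_deviation_le hV hlaw hθ (measurable_wrongAt hf i)
    (labeledAt_mem _ i) (growthLE_of_decisionAt M fun _ _ _ => labeledAt_congr) (by omega) hl
    ((i + 1 : ℕ) * complexityTerm d k δ M)
  have hle := hdev.trans (roundGrowth_pow_mul_exp_neg_le hd hM hk hδ hδ1 i.succ_pos)
  rwa [Nat.cast_succ] at hle

theorem measure_rightAt_deviation_le (hd : 1 ≤ d) (hk : 1 ≤ k) (hδ : 0 < δ) (hδ1 : δ < 1)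
    (hM : 16 * d ≤ M) (hf : ∀ s, MeasurableSet (f ⁻¹' {s})) (hV : Measurable V)
    (hlaw : μ.map V = Measure.pi fun _ => unifBall d) (hθ : Measurable θ) (i : ℕ) {l : ℝ}
    (hl : 0 < l) :
    μ.real {ω | l * sampleMean (V ω) (rightAt f i (θ ω)) +
        (i + 1) * complexityTerm d k δ M / (M * l) ≤
      sampleMean (V ω) (rightAt f i (θ ω)) - ∫ y, rightAt f i (θ ω) y ∂(unifBall d)} ≤
      δ / (8 * k) := by
  have := isProbabilityMeasure_unifBall d
  have hdev := measure_upper_relative_deviation_le hV hlaw hθ (measurable_rightAt hf i)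
    (labeledAt_mem _ i) (growthLE_of_decisionAt M fun _ _ _ => labeledAt_congr) (by omega) hl
    ((i + 1 : ℕ) * complexityTerm d k δ M)
  have hle := hdev.trans (roundGrowth_pow_mul_exp_neg_le hd hM hk hδ hδ1 i.succ_pos)
  rwa [Nat.cast_succ] at hle

theorem measure_undecided_deviation_le (hd : 1 ≤ d) (hk : 1 ≤ k) (hδ : 0 < δ) (hδ1 : δ < 1)
    (hN : d ≤ N) (hX : Measurable X) (hlaw : μ.map X = Measure.pi fun _ => unifBall d)
    (hθ : Measurable θ) :
    μ.real {ω | √(8 * (k * complexityTerm d k δ N) / N) ≤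
      sampleMean (X ω) (undecided k (θ ω)) - leftProb (θ ω) k} ≤
      (roundGrowth d N ^ k : ℕ) * Real.exp (-(k * complexityTerm d k δ N)) := by
  have := isProbabilityMeasure_unifBall d
  refine measure_deviation_le hX hlaw hθ (measurable_undecided k) (fun θ y => ?_)
    (growthLE_of_decisionAt N fun _ _ _ => undecided_congr) (by omega)
    (mul_nonneg k.cast_nonneg (complexityTerm_pos hd hN hk hδ hδ1).le)
  rcases undecided_mem k θ y with h | (h : _ = 1) <;> simp [h]

theorem measure_exists_mixture_deviation_le (hd : 1 ≤ d) (hk : 1 ≤ k) (hδ : 0 < δ) (hδ1 : δ < 1)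
    (hN : d ≤ N) (hf : ∀ s, MeasurableSet (f ⁻¹' {s})) (hX : Measurable X)
    (hlaw : μ.map X = Measure.pi fun _ => unifBall d) (hθ : Measurable θ) :
    μ.real {ω | ∃ S ⊆ Finset.range k, √(8 * (k * complexityTerm d k δ N) / N) ≤
      sampleMean (X ω) (mixture f k S (θ ω)) - ∫ y, mixture f k S (θ ω) y ∂(unifBall d)} ≤
      2 ^ k * ((roundGrowth d N ^ k : ℕ) * Real.exp (-(k * complexityTerm d k δ N))) := by
  have := isProbabilityMeasure_unifBall d
  have hunion : {ω | ∃ S ⊆ Finset.range k, √(8 * (k * complexityTerm d k δ N) / N) ≤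
      sampleMean (X ω) (mixture f k S (θ ω)) - ∫ y, mixture f k S (θ ω) y ∂(unifBall d)} =
      ⋃ S ∈ (Finset.range k).powerset, {ω | √(8 * (k * complexityTerm d k δ N) / N) ≤
        sampleMean (X ω) (mixture f k S (θ ω)) - ∫ y, mixture f k S (θ ω) y ∂(unifBall d)} := by
    ext ω
    simp
  rw [hunion]
  refine (measureReal_biUnion_finset_le _ _).trans ((Finset.sum_le_card_nsmul _ _ _ fun S _ =>
    measure_deviation_le hX hlaw hθ (measurable_mixture hf k S) (abs_mixture_le_one f k S)
      (growthLE_of_decisionAt N fun _ _ _ => mixture_congr) (by omega)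
      (mul_nonneg k.cast_nonneg (complexityTerm_pos hd hN hk hδ hδ1).le)).trans_eq ?_)
  simp

theorem measure_pool_deviation_le (hd : 1 ≤ d) (hk : 1 ≤ k) (hδ : 0 < δ) (hδ1 : δ < 1)
    (hN : 16 * d ≤ N) (hf : ∀ s, MeasurableSet (f ⁻¹' {s})) (hX : Measurable X)
    (hlaw : μ.map X = Measure.pi fun _ => unifBall d) (hθ : Measurable θ) :
    μ.real ({ω | ∃ S ⊆ Finset.range k, √(8 * (k * complexityTerm d k δ N) / N) ≤
        sampleMean (X ω) (mixture f k S (θ ω)) - ∫ y, mixture f k S (θ ω) y ∂(unifBall d)} ∪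
      {ω | √(8 * (k * complexityTerm d k δ N) / N) ≤
        sampleMean (X ω) (undecided k (θ ω)) - leftProb (θ ω) k}) ≤ δ / (8 * k) := by
  have hmix := measure_exists_mixture_deviation_le hd hk hδ hδ1 (by omega) hf hX hlaw hθ
  have hundec := measure_undecided_deviation_le hd hk hδ hδ1 (by omega) hX hlaw hθ
  have hcount : (2 : ℝ) ^ k + 1 ≤ 3 ^ k := by
    exact_mod_cast (Nat.pow_lt_pow_left (by norm_num : 2 < 3) (by omega) : 2 ^ k < 3 ^ k)
  calc _ ≤ (2 ^ k + 1) * ((roundGrowth d N ^ k : ℕ) *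
          Real.exp (-(k * complexityTerm d k δ N))) := by
        refine (measureReal_union_le _ _).trans ?_
        linarith
    _ ≤ (3 * (roundGrowth d N : ℝ)) ^ k * Real.exp (-(k * complexityTerm d k δ N)) := by
        rw [mul_pow, mul_assoc, Nat.cast_pow]
        gcongr
    _ ≤ δ / (8 * k) := three_mul_roundGrowth_pow_mul_exp_neg_le hd hN hk hδ hδ1 hk

theorem measure_not_smallDeviations_le (hd : 1 ≤ d) (hk : 1 ≤ k) (hδ : 0 < δ) (hδ1 : δ < 1)
    (hp : 0 < p₀) (hp1 : p₀ < 1) (hM : 16 * d ≤ M) (hN : 16 * d ≤ N)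
    (hf : ∀ s, MeasurableSet (f ⁻¹' {s})) (hX : Measurable X)
    (hXlaw : μ.map X = Measure.pi fun _ => unifBall d) (hV : Measurable V)
    (hVlaw : μ.map V = Measure.pi fun _ => unifBall d) (hθ : Measurable θ) :
    μ.real {ω | ¬ SmallDeviations f (X ω) (V ω) (θ ω) k δ p₀} ≤ δ / 2 := by
  have hk' : (1 : ℝ) ≤ k := by exact_mod_cast hk
  have hM0 : (0 : ℝ) < M := by exact_mod_cast (by omega : 0 < M)
  have hscale := roundScale_pos hp hp1 (complexityTerm_pos hd (by omega : d ≤ M) hk hδ hδ1) hM0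
  have hwrong := measureReal_exists_lt_le
    (fun i => measure_wrongAt_deviation_le hd hk hδ hδ1 hM hf hV hVlaw hθ i (hscale i)) k
  have hright := measureReal_exists_lt_le
    (fun i => measure_rightAt_deviation_le hd hk hδ hδ1 hM hf hV hVlaw hθ i (hscale i)) k
  have hpool := measure_pool_deviation_le hd hk hδ hδ1 hN hf hX hXlaw hθ
  have hrounds : k * (δ / (8 * k)) = δ / 8 := by field_simp
  have hround_le : δ / (8 * k) ≤ k * (δ / (8 * k)) :=
    le_mul_of_one_le_left (by positivity) hk'
  refine (measureReal_mono fun ω hω => ?_).trans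
    ((measureReal_union_le _ _).trans
      ((add_le_add (measureReal_union_le _ _) le_rfl).trans
        (add_le_add (add_le_add hwrong hright) hpool |>.trans ?_)))
  · by_contra hsmall
    simp only [Set.mem_union, Set.mem_ofPred_eq, not_or, not_exists, not_and, not_le] at hsmall hω
    exact hω ⟨hsmall.1.1, hsmall.1.2, hsmall.2.1, hsmall.2.2⟩
  · linarith

end SmallDeviations

section DeviationTransfer

variable {k : ℕ} {a b A B x u v : ℕ → ℝ} {D s t p₀ ρ : ℝ}

theorem sum_mix_le_of_forall_finset (hx0 : ∀ i < k, 0 ≤ x i) (hx1 : ∀ i < k, x i ≤ 1)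
    (h : ∀ S ⊆ Finset.range k, ∑ i ∈ Finset.range k, (if i ∈ S then u i else -v i) ≤ D) :
    ∑ i ∈ Finset.range k, ((1 - x i) * u i - x i * v i) ≤ D := by
  refine le_trans (Finset.sum_le_sum fun i hi => ?_)
    (h ((Finset.range k).filter fun i => -v i ≤ u i) (Finset.filter_subset _ _))
  have hi0 := hx0 i (Finset.mem_range.1 hi)
  have hi1 := hx1 i (Finset.mem_range.1 hi)
  simp only [Finset.mem_filter, hi, true_and]
  split_ifs with huv
  · linarith [mul_le_mul_of_nonneg_left huv hi0]
  · linarith [mul_le_mul_of_nonneg_left (not_le.1 huv).le (sub_nonneg.2 hi1)]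

theorem sum_sub_mul_le_of_deviations
    (hval : ∑ i ∈ Finset.range k, (a i - x i * (a i + b i)) ≤ ρ * s) (hρ : p₀ ≤ ρ) (hs : 0 ≤ s)
    (ht : 0 ≤ t) (hst : s + t ≤ 1) (hD0 : 0 ≤ D) (hD : 2 * D ≤ p₀ * t)
    (hdev : ∑ i ∈ Finset.range k, ((1 - x i) * (A i - a i) - x i * (B i - b i)) ≤ D)
    (hcov : ρ - ∑ i ∈ Finset.range k, (A i + B i) ≤ D) :
    ∑ i ∈ Finset.range k, (A i - x i * (A i + B i)) ≤
      (s + t) * ∑ i ∈ Finset.range k, (A i + B i) := by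
  have hDst : D * (s + t) ≤ D := mul_le_of_le_one_right hD0 hst
  have hDt : 2 * D ≤ ρ * t := hD.trans (mul_le_mul_of_nonneg_right hρ ht)
  calc ∑ i ∈ Finset.range k, (A i - x i * (A i + B i))
      = ∑ i ∈ Finset.range k, (a i - x i * (a i + b i)) +
          ∑ i ∈ Finset.range k, ((1 - x i) * (A i - a i) - x i * (B i - b i)) := by
        rw [← Finset.sum_add_distrib]
        exact Finset.sum_congr rfl fun i _ => by ring
    _ ≤ ρ * s + D := add_le_add hval hdev
    _ ≤ (s + t) * (ρ - D) := by linarith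
    _ ≤ (s + t) * ∑ i ∈ Finset.range k, (A i + B i) :=
        mul_le_mul_of_nonneg_left (by linarith) (add_nonneg hs ht)

end DeviationTransfer

section AutoLabelingError

variable {d k N M : ℕ} {δ p₀ : ℝ} {f : E d → SignType} {X : Fin N → E d} {V : Fin M → E d}
  {W : ℕ → E d} {T : ℕ → EReal}

theorem empCondErr_nonneg (f : E d → SignType) (z : Fin N → E d) (W : ℕ → E d) (T : ℕ → EReal)
    (i : ℕ) : 0 ≤ empCondErr f z (remaining z W T i) (W i) (T i) := by
  rw [empCondErr_eq]
  have hwrong := sampleMean_nonneg z (labeledAt_nonneg (fun s y => s ≠ f y) i (W, T))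
  have hright := sampleMean_nonneg z (labeledAt_nonneg (fun s y => s = f y) i (W, T))
  positivity

theorem empCondErr_le_one (f : E d → SignType) (z : Fin N → E d) (W : ℕ → E d) (T : ℕ → EReal)
    (i : ℕ) : empCondErr f z (remaining z W T i) (W i) (T i) ≤ 1 := by
  rw [empCondErr_eq]
  have hwrong := sampleMean_nonneg z (labeledAt_nonneg (fun s y => s ≠ f y) i (W, T))
  have hright := sampleMean_nonneg z (labeledAt_nonneg (fun s y => s = f y) i (W, T))
  exact div_le_one_of_le₀ (le_add_of_nonneg_right hright) (add_nonneg hwrong hright)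

theorem card_autoRound_div (f : E d → SignType) (X : Fin N → E d) (W : ℕ → E d) (T : ℕ → EReal)
    (k i : ℕ) :
    ((autoRound X W T i).card : ℝ) / (∑ j ∈ Finset.range k, (autoRound X W T j).card : ℕ) =
      (sampleMean X (wrongAt f i (W, T)) + sampleMean X (rightAt f i (W, T))) /
        ∑ j ∈ Finset.range k,
          (sampleMean X (wrongAt f j (W, T)) + sampleMean X (rightAt f j (W, T))) := by
  rw [← card_autoLabeled, cast_card_autoLabeled_eq f, autoRound, card_accepted_eq f]
  rcases Nat.eq_zero_or_pos N with rfl | hN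
  · simp [sampleMean]
  · exact mul_div_mul_left _ _ (by positivity)

theorem le_one_sub_leftProb (hk : 1 ≤ k) (hp : 0 < p₀) (hp1 : p₀ < 1)
    (haccept : ∀ i < k, p₀ ≤ acceptProb (W i) (T i) (region W T i)) :
    p₀ ≤ 1 - leftProb (W, T) k := by
  have hpow : leftProb (W, T) k ≤ (1 - p₀) ^ k := le_pow_of_mul_le_sub_succ hp1.le
    (leftProb_zero _) (fun i hi => mul_leftProb_le_of_le_acceptProb hp (haccept i hi)) k le_rfl
  have hbase : (1 - p₀) ^ k ≤ 1 - p₀ :=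
    pow_le_of_le_one (by linarith) (by linarith) (by omega)
  linarith

theorem two_mul_sqrt_eight_mul_div (hp : 0 < p₀) (c C : ℝ) :
    2 * √(8 * (c * C) / N) = p₀ * (4 / p₀ * √(2 * c / N * C)) := by
  have hsplit : 8 * (c * C) / N = 2 ^ 2 * (2 * c / N * C) := by ring
  rw [hsplit, Real.sqrt_mul (by positivity), Real.sqrt_sq zero_le_two, ← mul_assoc p₀,
    mul_div_cancel₀ _ hp.ne', ← mul_assoc]
  norm_num

namespace SmallDeviations

theorem sum_integral_sub_empCondErr_mul_le (h : SmallDeviations f X V (W, T) k δ p₀)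
    (hd : 1 ≤ d) (hk : 1 ≤ k) (hδ : 0 < δ) (hδ1 : δ < 1) (hp : 0 < p₀) (hp1 : p₀ < 1)
    (hM : d ≤ M) (hf : ∀ s, MeasurableSet (f ⁻¹' {s}))
    (haccept : ∀ i < k, p₀ ≤ acceptProb (W i) (T i) (region W T i))
    (hne : ∀ i < k, (accepted V (remaining V W T i) (W i) (T i)).Nonempty) :
    ∑ i ∈ Finset.range k, (∫ y, wrongAt f i (W, T) y ∂(unifBall d) -
        empCondErr f V (remaining V W T i) (W i) (T i) *
          (∫ y, wrongAt f i (W, T) y ∂(unifBall d) + ∫ y, rightAt f i (W, T) y ∂(unifBall d))) ≤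
      (1 - leftProb (W, T) k) * (4 / p₀ * √(2 / M * complexityTerm d k δ M)) := by
  have hC : 0 < complexityTerm d k δ M := complexityTerm_pos hd hM hk hδ hδ1
  have hM0 : (0 : ℝ) < M := by exact_mod_cast hd.trans hM
  have hstep := fun i hi => mul_leftProb_le_of_le_acceptProb hp (haccept i hi)
  refine le_trans (Finset.sum_le_sum fun i hi => ?_)
    (sum_roundScale_le hp hp1 hC hM0 (leftProb_zero (W, T)) (leftProb_nonneg (W, T)) hstep)
  have hik := Finset.mem_range.1 hi
  have hmass := integral_wrongAt_add_integral_rightAt hf (W, T) i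
  have hscale := roundScale_pos hp hp1 hC hM0 i
  have hmass_pos : 0 < leftProb (W, T) i - leftProb (W, T) (i + 1) :=
    (mul_pos hp (leftProb_pos_of_acceptProb_pos (hp.trans_le (haccept i hik)))).trans_le
      (hstep i hik)
  have hsample_pos : 0 < sampleMean V (wrongAt f i (W, T)) + sampleMean V (rightAt f i (W, T)) := by
    have hcard : (0 : ℝ) < (accepted V (remaining V W T i) (W i) (T i)).card := by
      exact_mod_cast (hne i hik).card_pos
    rw [card_accepted_eq f] at hcard
    exact pos_of_mul_pos_right hcard hM0.le
  rw [empCondErr_eq, ← hmass]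
  exact error_sub_empirical_mul_le (integral_nonneg (labeledAt_nonneg _ i _))
    (integral_nonneg (labeledAt_nonneg _ i _)) (hmass ▸ hmass_pos)
    (sampleMean_nonneg V (labeledAt_nonneg _ i _)) (sampleMean_nonneg V (labeledAt_nonneg _ i _))
    hsample_pos hscale.le (by positivity) (h.wrong_lt i hik).le (h.right_lt i hik).le

theorem sum_mix_sampleMean_sub_integral_le (h : SmallDeviations f X V (W, T) k δ p₀)
    (hf : ∀ s, MeasurableSet (f ⁻¹' {s})) {x : ℕ → ℝ} (hx0 : ∀ i < k, 0 ≤ x i)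
    (hx1 : ∀ i < k, x i ≤ 1) :
    ∑ i ∈ Finset.range k, ((1 - x i) *
        (sampleMean X (wrongAt f i (W, T)) - ∫ y, wrongAt f i (W, T) y ∂(unifBall d)) -
      x i * (sampleMean X (rightAt f i (W, T)) - ∫ y, rightAt f i (W, T) y ∂(unifBall d))) ≤
      √(8 * (k * complexityTerm d k δ N) / N) := by
  refine sum_mix_le_of_forall_finset hx0 hx1 fun S hS => ?_
  have hmix := h.mixture_lt S hS
  rw [sampleMean_mixture, integral_mixture hf, ← Finset.sum_sub_distrib] at hmix
  refine le_trans (Finset.sum_le_sum fun i _ => ?_) hmix.le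
  split_ifs
  · rfl
  · linarith

theorem autoErr_le (h : SmallDeviations f X V (W, T) k δ p₀)
    (hd : 1 ≤ d) (hk : 1 ≤ k) (hδ : 0 < δ) (hδ1 : δ < 1) (hp : 0 < p₀) (hp1 : p₀ < 1)
    (hM : d ≤ M) (hf : ∀ s, MeasurableSet (f ⁻¹' {s}))
    (haccept : ∀ i < k, p₀ ≤ acceptProb (W i) (T i) (region W T i))
    (hne : ∀ i < k, (accepted V (remaining V W T i) (W i) (T i)).Nonempty)
    (hNa : 0 < ∑ i ∈ Finset.range k, (autoRound X W T i).card)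
    (hsmall : 4 / p₀ * √(2 / M * complexityTerm d k δ M) +
      4 / p₀ * √(2 * k / N * complexityTerm d k δ N) ≤ 1) :
    autoErr f X W T k ≤
      ∑ i ∈ Finset.range k, ((autoRound X W T i).card : ℝ) /
          (∑ j ∈ Finset.range k, (autoRound X W T j).card : ℕ) *
        empCondErr f V (remaining V W T i) (W i) (T i) +
      (4 / p₀ * √(2 / M * complexityTerm d k δ M) +
        4 / p₀ * √(2 * k / N * complexityTerm d k δ N)) := by
  set s := 4 / p₀ * √(2 / M * complexityTerm d k δ M)
  set t := 4 / p₀ * √(2 * k / N * complexityTerm d k δ N)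
  rw [← card_autoLabeled, ← Nat.cast_pos (α := ℝ), cast_card_autoLabeled_eq f] at hNa
  have hmass := pos_of_mul_pos_right hNa N.cast_nonneg
  have hN : 0 < N := Nat.cast_pos.1 (pos_of_mul_pos_left hNa hmass.le)
  have hcov : 1 - leftProb (W, T) k - ∑ i ∈ Finset.range k,
      (sampleMean X (wrongAt f i (W, T)) + sampleMean X (rightAt f i (W, T))) ≤
      √(8 * (k * complexityTerm d k δ N) / N) := by
    rw [sum_sampleMean_wrongAt_add_sampleMean_rightAt f X hN]
    linarith [h.undecided_lt]
  have hsum := sum_sub_mul_le_of_deviations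
    (h.sum_integral_sub_empCondErr_mul_le hd hk hδ hδ1 hp hp1 hM hf haccept hne)
    (le_one_sub_leftProb hk hp hp1 haccept) (by positivity : 0 ≤ s) (by positivity : 0 ≤ t) hsmall
    (Real.sqrt_nonneg _) (two_mul_sqrt_eight_mul_div hp _ _).le
    (h.sum_mix_sampleMean_sub_integral_le hf (fun i _ => empCondErr_nonneg f V W T i)
      fun i _ => empCondErr_le_one f V W T i) hcov
  rw [Finset.sum_sub_distrib, sub_le_iff_le_add'] at hsum
  have hweights : (∑ i ∈ Finset.range k, ((autoRound X W T i).card : ℝ) /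
        (∑ j ∈ Finset.range k, (autoRound X W T j).card : ℕ) *
          empCondErr f V (remaining V W T i) (W i) (T i)) *
        ∑ i ∈ Finset.range k,
          (sampleMean X (wrongAt f i (W, T)) + sampleMean X (rightAt f i (W, T))) =
      ∑ i ∈ Finset.range k, empCondErr f V (remaining V W T i) (W i) (T i) *
        (sampleMean X (wrongAt f i (W, T)) + sampleMean X (rightAt f i (W, T))) := by
    rw [Finset.sum_mul]
    refine Finset.sum_congr rfl fun i _ => ?_
    rw [card_autoRound_div f]
    field_simp
  rw [autoErr_eq, div_le_iff₀ hmass, add_mul, hweights]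
  exact hsum

end SmallDeviations

end AutoLabelingError

section ErrorBound

variable {d k N M : ℕ} {δ p₀ : ℝ} {f : E d → SignType} {X : Fin N → E d} {V : Fin M → E d}
  {W : ℕ → E d} {T : ℕ → EReal}

/-- The auto-labeling error is at most the average of the validation errors of the rounds plus the
complexity penalties of the validation sample and of the auto-labeled points, provided that every
round labels a fraction at least `p₀` of its region and that there are enough validation and
auto-labeled points. -/
def ErrorBound (f : E d → SignType) (X : Fin N → E d) (V : Fin M → E d) (W : ℕ → E d)
    (T : ℕ → EReal) (k : ℕ) (δ p₀ : ℝ) : Prop :=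
  (∀ i < k, p₀ ≤ acceptProb (W i) (T i) (region W T i)) →
  (∀ i < k, d ≤ (remaining V W T i).card) →
  d ≤ ∑ i ∈ Finset.range k, (autoRound X W T i).card →
  autoErr f X W T k ≤
    ∑ i ∈ Finset.range k, ((autoRound X W T i).card : ℝ) /
        (∑ j ∈ Finset.range k, (autoRound X W T j).card : ℕ) *
      (empCondErr f V (remaining V W T i) (W i) (T i) +
        4 / p₀ * √(2 / ((remaining V W T i).card : ℝ) *
          complexityTerm d k δ (remaining V W T i).card)) +
    4 / p₀ * √(2 * (k : ℝ) / (∑ j ∈ Finset.range k, (autoRound X W T j).card : ℕ) *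
      complexityTerm d k δ (∑ j ∈ Finset.range k, (autoRound X W T j).card))

theorem remaining_card_le (z : Fin N → E d) (W : ℕ → E d) (T : ℕ → EReal) (i : ℕ) :
    (remaining z W T i).card ≤ N :=
  (Finset.card_le_univ _).trans_eq (Fintype.card_fin N)

theorem sum_card_autoRound_le (X : Fin N → E d) (W : ℕ → E d) (T : ℕ → EReal) (k : ℕ) :
    ∑ i ∈ Finset.range k, (autoRound X W T i).card ≤ N := by
  rw [← card_autoLabeled]
  exact (Finset.card_le_univ _).trans_eq (Fintype.card_fin N)

theorem weighted_sum_add_le (hd : 1 ≤ d) (hk : 1 ≤ k) (hδ : 0 < δ) (hδ1 : δ < 1) (hp : 0 < p₀)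
    {na nv : ℕ → ℕ} {x : ℕ → ℝ} (hnv : ∀ i < k, d ≤ nv i) (hnvM : ∀ i < k, nv i ≤ M)
    (hna : d ≤ ∑ i ∈ Finset.range k, na i) (hnaN : ∑ i ∈ Finset.range k, na i ≤ N) :
    ∑ i ∈ Finset.range k, (na i : ℝ) / (∑ j ∈ Finset.range k, na j : ℕ) * x i +
        (4 / p₀ * √(2 / M * complexityTerm d k δ M) +
          4 / p₀ * √(2 * k / N * complexityTerm d k δ N)) ≤
      ∑ i ∈ Finset.range k, (na i : ℝ) / (∑ j ∈ Finset.range k, na j : ℕ) *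
          (x i + 4 / p₀ * √(2 / (nv i : ℝ) * complexityTerm d k δ (nv i))) +
        4 / p₀ * √(2 * (k : ℝ) / (∑ j ∈ Finset.range k, na j : ℕ) *
          complexityTerm d k δ (∑ j ∈ Finset.range k, na j)) := by
  have htotal : (0 : ℝ) < (∑ j ∈ Finset.range k, na j : ℕ) := by exact_mod_cast hd.trans hna
  have hweights : ∑ i ∈ Finset.range k, (na i : ℝ) / (∑ j ∈ Finset.range k, na j : ℕ) = 1 := by
    rw [← Finset.sum_div, ← Nat.cast_sum, div_self htotal.ne']
  have hpool : 4 / p₀ * √(2 * k / N * complexityTerm d k δ N) ≤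
      4 / p₀ * √(2 * (k : ℝ) / (∑ j ∈ Finset.range k, na j : ℕ) *
        complexityTerm d k δ (∑ j ∈ Finset.range k, na j)) := by
    gcongr 4 / p₀ * ?_
    exact sqrt_div_mul_complexityTerm_anti hd hna hnaN hk hδ hδ1 (by positivity)
  rw [← add_assoc]
  refine add_le_add ?_ hpool
  rw [← one_mul (4 / p₀ * √(2 / M * complexityTerm d k δ M)), ← hweights, Finset.sum_mul,
    ← Finset.sum_add_distrib]
  refine Finset.sum_le_sum fun i hi => ?_
  have hik := Finset.mem_range.1 hi
  rw [← mul_add]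
  gcongr _ * (_ + 4 / p₀ * ?_)
  exact sqrt_div_mul_complexityTerm_anti hd (hnv i hik) (hnvM i hik) hk hδ hδ1 zero_le_two

theorem errorBound_of_autoErr_le (hd : 1 ≤ d) (hk : 1 ≤ k) (hδ : 0 < δ) (hδ1 : δ < 1) (hp : 0 < p₀)
    (h : (∀ i < k, p₀ ≤ acceptProb (W i) (T i) (region W T i)) →
      0 < ∑ i ∈ Finset.range k, (autoRound X W T i).card →
      autoErr f X W T k ≤
        ∑ i ∈ Finset.range k, ((autoRound X W T i).card : ℝ) /
            (∑ j ∈ Finset.range k, (autoRound X W T j).card : ℕ) *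
          empCondErr f V (remaining V W T i) (W i) (T i) +
        (4 / p₀ * √(2 / M * complexityTerm d k δ M) +
          4 / p₀ * √(2 * k / N * complexityTerm d k δ N))) :
    ErrorBound f X V W T k δ p₀ := fun haccept hnv hna =>
  (h haccept (by omega)).trans (weighted_sum_add_le hd hk hδ hδ1 hp hnv
    (fun i _ => remaining_card_le V W T i) hna (sum_card_autoRound_le X W T k))

theorem errorBound_of_one_le (hd : 1 ≤ d) (hk : 1 ≤ k) (hδ : 0 < δ) (hδ1 : δ < 1) (hp : 0 < p₀)
    (h : 1 ≤ 4 / p₀ * √(2 / M * complexityTerm d k δ M) +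
      4 / p₀ * √(2 * k / N * complexityTerm d k δ N)) :
    ErrorBound f X V W T k δ p₀ := by
  refine errorBound_of_autoErr_le hd hk hδ hδ1 hp fun _ _ => ?_
  refine (autoErr_le_one f X W T k).trans (h.trans (le_add_of_nonneg_left ?_))
  exact Finset.sum_nonneg fun i _ => mul_nonneg (by positivity) (empCondErr_nonneg f V W T i)

theorem SmallDeviations.errorBound (h : SmallDeviations f X V (W, T) k δ p₀) (hd : 1 ≤ d)
    (hk : 1 ≤ k) (hδ : 0 < δ) (hδ1 : δ < 1) (hp : 0 < p₀) (hp1 : p₀ < 1) (hM : d ≤ M)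
    (hf : ∀ s, MeasurableSet (f ⁻¹' {s}))
    (hsmall : 4 / p₀ * √(2 / M * complexityTerm d k δ M) +
      4 / p₀ * √(2 * k / N * complexityTerm d k δ N) ≤ 1)
    (hT : ∀ i < k, T i = ⊤ ∨ (accepted V (remaining V W T i) (W i) (T i)).Nonempty) :
    ErrorBound f X V W T k δ p₀ := by
  refine errorBound_of_autoErr_le hd hk hδ hδ1 hp fun haccept hna => ?_
  refine h.autoErr_le hd hk hδ hδ1 hp hp1 hM hf haccept (fun i hi => ?_) hna hsmall
  refine (hT i hi).resolve_left fun htop => ?_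
  have hle := haccept i hi
  rw [htop, acceptProb_top] at hle
  exact hp.not_ge hle

variable {Ω : Type*} [MeasurableSpace Ω] {μ : Measure Ω} [IsProbabilityMeasure μ]

theorem one_sub_le_measureReal_of_compl_subset {A B : Set Ω} {ε : ℝ} (hAB : Aᶜ ⊆ B)
    (hB : μ.real B ≤ ε) : 1 - ε ≤ μ.real A := by
  have hunion : (1 : ℝ) ≤ μ.real A + μ.real Aᶜ := by
    rw [← probReal_univ (μ := μ), ← Set.union_compl_self A]
    exact measureReal_union_le A Aᶜ
  linarith [measureReal_mono (μ := μ) hAB]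

theorem one_sub_le_measure_errorBound (hd : 1 ≤ d) (hN : d ≤ N) (hk : 1 ≤ k) (hδ : 0 < δ)
    (hδ1 : δ < 1) (hp : 0 < p₀) (hp1 : p₀ < 1) (hf : ∀ s, MeasurableSet (f ⁻¹' {s}))
    {X : Ω → Fin N → E d} (hX : Measurable X)
    (hXlaw : μ.map X = Measure.pi fun _ => unifBall d) {V : Ω → Fin M → E d} (hV : Measurable V)
    (hVlaw : μ.map V = Measure.pi fun _ => unifBall d) {θ : Ω → RunParams d} (hθ : Measurable θ)
    (hT : ∀ ω, ∀ i < k, (θ ω).2 i = ⊤ ∨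
      (accepted (V ω) (remaining (V ω) (θ ω).1 (θ ω).2 i) ((θ ω).1 i) ((θ ω).2 i)).Nonempty) :
    1 - δ / 2 ≤ μ.real {ω | ErrorBound f (X ω) (V ω) (θ ω).1 (θ ω).2 k δ p₀} := by
  have hall (h : ∀ ω, ErrorBound f (X ω) (V ω) (θ ω).1 (θ ω).2 k δ p₀) :
      1 - δ / 2 ≤ μ.real {ω | ErrorBound f (X ω) (V ω) (θ ω).1 (θ ω).2 k δ p₀} := by
    rw [(Set.eq_univ_of_forall h : {ω | ErrorBound f (X ω) (V ω) (θ ω).1 (θ ω).2 k δ p₀} = _),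
      probReal_univ]
    linarith
  by_cases hM : d ≤ M
  swap
  · exact hall fun ω _ hnv _ => absurd ((hnv 0 hk).trans (remaining_card_le _ _ _ _)) hM
  by_cases hsmall : 1 ≤ 4 / p₀ * √(2 / M * complexityTerm d k δ M) +
      4 / p₀ * √(2 * k / N * complexityTerm d k δ N)
  · exact hall fun ω => errorBound_of_one_le hd hk hδ hδ1 hp hsmall
  have hk' : (1 : ℝ) ≤ k := by exact_mod_cast hk
  have hM16 : 16 * d ≤ M := sixteen_mul_le_of_mul_sqrt_lt_one hd hM hk hδ hδ1 hp hp1 le_rfl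
    ((le_add_of_nonneg_right (by positivity)).trans_lt (not_le.1 hsmall))
  have hN16 : 16 * d ≤ N := sixteen_mul_le_of_mul_sqrt_lt_one hd hN hk hδ hδ1 hp hp1
    (by linarith) ((le_add_of_nonneg_left (by positivity)).trans_lt (not_le.1 hsmall))
  have hdev :=
    measure_not_smallDeviations_le hd hk hδ hδ1 hp hp1 hM16 hN16 hf hX hXlaw hV hVlaw hθ
  refine one_sub_le_measureReal_of_compl_subset ?_ hdev
  intro ω hω hgood
  exact hω (SmallDeviations.errorBound hgood hd hk hδ hδ1 hp hp1 hM hf (not_le.1 hsmall).le (hT ω))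

end ErrorBound

section CoverageBound

variable {d N k : ℕ} {δ : ℝ} {X : Fin N → E d} {W : ℕ → E d} {T : ℕ → EReal}

/-- The coverage bound of part (2) for one realization of the pool, the classifiers and the
thresholds. It is an inequality in `EReal`, since a threshold may be `∞`. -/
def CoverageBound (X : Fin N → E d) (W : ℕ → E d) (T : ℕ → EReal) (k : ℕ) (δ : ℝ) : Prop :=
  (1 : EReal) - (⨅ i : Fin k, T i) * ((√(4 * (d : ℝ) / Real.pi) : ℝ) : EReal)
      - ((2 * (k : ℝ) * √(2 / (N : ℝ) * complexityTerm d k δ N) : ℝ) : EReal)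
    ≤ ((coverage X W T k : ℝ) : EReal)

theorem leftProb_le_mul_sqrt (hd : 1 ≤ d) {i : ℕ} (hi : i < k) (hW : ‖W i‖ = 1) {t : ℝ}
    (ht : 0 ≤ t) (hTi : T i = t) : leftProb (W, T) k ≤ t * √(4 * d / Real.pi) := by
  have := isProbabilityMeasure_unifBall d
  rw [leftProb_eq_real]
  refine (measureReal_mono fun y hy => ?_).trans (unifBall_real_slab_le hd hW ht)
  simpa [Accepts, hTi] using hy i hi

theorem coverageBound_of_forall_real (hd : 1 ≤ d) (hk : 1 ≤ k)
    (hT : ∀ i < k, T i = ⊤ ∨ 0 ≤ T i)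
    (h : ∀ i < k, ∀ t : ℝ, 0 ≤ t → T i = t → 1 - t * √(4 * d / Real.pi) -
      2 * k * √(2 / N * complexityTerm d k δ N) ≤ coverage X W T k) :
    CoverageBound X W T k δ := by
  have : Nonempty (Fin k) := ⟨⟨0, hk⟩⟩
  obtain ⟨i, hmin⟩ := exists_eq_ciInf_of_finite (f := fun i : Fin k => T i)
  have hsqrt : 0 < √(4 * d / Real.pi) := Real.sqrt_pos.2 (by positivity)
  rw [CoverageBound, ← hmin]
  rcases hT i i.2 with htop | hnonneg
  · rw [htop, EReal.top_mul_coe_of_pos hsqrt]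
    simp
  · induction hTi : T i with
    | bot => simp [hTi] at hnonneg
    | top =>
      rw [EReal.top_mul_coe_of_pos hsqrt]
      simp
    | coe t =>
      rw [← EReal.coe_one, ← EReal.coe_mul, ← EReal.coe_sub, ← EReal.coe_sub,
        EReal.coe_le_coe_iff]
      exact h i i.2 t (by simpa [hTi] using hnonneg) hTi

theorem sqrt_eight_mul_div_le (hk : 1 ≤ k) {C : ℝ} :
    √(8 * (k * C) / N) ≤ 2 * k * √(2 / N * C) := by
  have hk' : (1 : ℝ) ≤ k := by exact_mod_cast hk
  calc √(8 * (k * C) / N) = √(4 * k * (2 / N * C)) := by congr 1; ring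
    _ = √(4 * k) * √(2 / N * C) := Real.sqrt_mul (by positivity) _
    _ ≤ 2 * k * √(2 / N * C) := by
        gcongr
        exact Real.sqrt_le_iff.2 ⟨by positivity, by nlinarith⟩

theorem coverageBound_of_deviation_lt (hd : 1 ≤ d) (hN : d ≤ N) (hk : 1 ≤ k)
    (hW : ∀ i < k, ‖W i‖ = 1) (hT : ∀ i < k, T i = ⊤ ∨ 0 ≤ T i)
    (hdev : sampleMean X (undecided k (W, T)) - leftProb (W, T) k <
      √(8 * (k * complexityTerm d k δ N) / N)) : CoverageBound X W T k δ := by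
  refine coverageBound_of_forall_real hd hk hT fun i hi t ht hTi => ?_
  rw [coverage_eq X W T k (by omega)]
  linarith [leftProb_le_mul_sqrt hd hi (hW i hi) ht hTi,
    sqrt_eight_mul_div_le (N := N) hk (C := complexityTerm d k δ N)]

theorem coverageBound_of_lt_sixteen_mul (hd : 1 ≤ d) (hN : d ≤ N) (hN16 : N < 16 * d)
    (hk : 1 ≤ k) (hδ : 0 < δ) (hδ1 : δ < 1) (hT : ∀ i < k, T i = ⊤ ∨ 0 ≤ T i) :
    CoverageBound X W T k δ := by
  refine coverageBound_of_forall_real hd hk hT fun _ _ t ht _ => ?_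
  have hN0 : (0 : ℝ) < N := by exact_mod_cast (by omega : 0 < N)
  have hN16' : (N : ℝ) < 16 * d := by exact_mod_cast hN16
  have hk' : (1 : ℝ) ≤ k := by exact_mod_cast hk
  have hsqrt : 1 ≤ √(8 * (k * complexityTerm d k δ N) / N) := by
    rw [Real.one_le_sqrt, one_le_div hN0]
    nlinarith [two_mul_le_complexityTerm hd hN hk hδ hδ1]
  have hcoverage : 0 ≤ coverage X W T k := div_nonneg (Nat.cast_nonneg _) N.cast_nonneg
  have hslab : 0 ≤ t * √(4 * d / Real.pi) := by positivity
  linarith [sqrt_eight_mul_div_le (N := N) hk (C := complexityTerm d k δ N)]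

variable {Ω : Type*} [MeasurableSpace Ω] {μ : Measure Ω} [IsProbabilityMeasure μ]

theorem one_sub_le_measure_coverageBound (hd : 1 ≤ d) (hN : d ≤ N) (hk : 1 ≤ k) (hδ : 0 < δ)
    (hδ1 : δ < 1) {X : Ω → Fin N → E d} (hX : Measurable X)
    (hXlaw : μ.map X = Measure.pi fun _ => unifBall d) {θ : Ω → RunParams d} (hθ : Measurable θ)
    (hW : ∀ ω, ∀ i < k, ‖(θ ω).1 i‖ = 1) (hT : ∀ ω, ∀ i < k, (θ ω).2 i = ⊤ ∨ 0 ≤ (θ ω).2 i) :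
    1 - δ / 2 ≤ μ.real {ω | CoverageBound (X ω) (θ ω).1 (θ ω).2 k δ} := by
  rcases lt_or_ge N (16 * d) with hN16 | hN16
  · rw [Set.eq_univ_of_forall (s := {ω | CoverageBound (X ω) (θ ω).1 (θ ω).2 k δ}) fun ω =>
      coverageBound_of_lt_sixteen_mul hd hN hN16 hk hδ hδ1 (hT ω), probReal_univ]
    linarith
  have hk' : (1 : ℝ) ≤ k := by exact_mod_cast hk
  have hδk : δ / (8 * k) ≤ δ / 2 := div_le_div_of_nonneg_left hδ.le two_pos (by linarith)
  have hdev := (measure_undecided_deviation_le hd hk hδ hδ1 hN hX hXlaw hθ).trans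
    ((roundGrowth_pow_mul_exp_neg_le hd hN16 hk hδ hδ1 hk).trans hδk)
  refine one_sub_le_measureReal_of_compl_subset ?_ hdev
  intro ω hω
  by_contra hdev
  exact hω (coverageBound_of_deviation_lt hd hN hk (hW ω) (hT ω) (not_le.1 hdev))

end CoverageBound

section Sampling

variable {Ω : Type*} [MeasurableSpace Ω] {μ : Measure Ω} [IsProbabilityMeasure μ] {d n : ℕ}

theorem map_sample_eq_pi {y : Fin n → Ω → E d} (hy : ∀ m, Measurable (y m))
    (hlaw : ∀ m, μ.map (y m) = unifBall d) (hind : iIndepFun y μ) :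
    μ.map (fun ω m => y m ω) = Measure.pi fun _ => unifBall d := by
  rw [(iIndepFun_iff_map_fun_eq_pi_map fun m => (hy m).aemeasurable).1 hind]
  simp only [hlaw]

end Sampling

theorem IsTBALRun.threshold_eq_top_or {d N M k : ℕ} {par : Params d} {f : E d → SignType}
    {x : Fin N → E d} {v : Fin M → E d} {Q : ℕ → Finset (Fin N)} {w : ℕ → E d} {t : ℕ → EReal}
    (h : IsTBALRun par f x v k Q w t) (hn₀ : 1 ≤ par.n₀) {i : ℕ} (hi : i < k) :
    t i = ⊤ ∨ 0 ≤ t i ∧ (accepted v (remaining v w t i) (w i) (t i)).Nonempty := by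
  rcases (h.threshold i hi).1 with htop | ⟨m, -, hscore, hcard, -⟩
  · exact .inl htop
  · refine .inr ⟨?_, Finset.card_pos.1 (hn₀.trans hcard)⟩
    rw [hscore, EReal.coe_nonneg]
    exact abs_nonneg _

end AutoLabel

theorem mainTheorem3_general {Ω : Type*} [MeasurableSpace Ω] (μ : Measure Ω)
    [IsProbabilityMeasure μ] (d N M k : ℕ) (hd : 1 ≤ d) (hN : d ≤ N) (hk : 1 ≤ k)
    (δ p₀ : ℝ) (hδ : 0 < δ) (hδ1 : δ < 1) (hp : 0 < p₀) (hp1 : p₀ < 1)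
    (f : AutoLabel.E d → SignType) (hf : ∀ s, MeasurableSet (f ⁻¹' {s}))
    (x : Fin N → Ω → AutoLabel.E d) (v : Fin M → Ω → AutoLabel.E d)
    (hx : ∀ m, Measurable (x m)) (hv : ∀ j, Measurable (v j))
    (hxlaw : ∀ m, μ.map (x m) = AutoLabel.unifBall d)
    (hvlaw : ∀ j, μ.map (v j) = AutoLabel.unifBall d)
    (hxind : iIndepFun x μ) (hvind : iIndepFun v μ)
    (w : ℕ → Ω → AutoLabel.E d) (t : ℕ → Ω → EReal)
    (hw : ∀ i, Measurable (w i)) (ht : ∀ i, Measurable (t i))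
    (hnorm : ∀ ω, ∀ i < k, ‖w i ω‖ = 1)
    (hthreshold : ∀ ω, ∀ i < k, t i ω = ⊤ ∨ 0 ≤ t i ω ∧
      (AutoLabel.accepted (fun j => v j ω)
        (AutoLabel.remaining (fun j => v j ω) (fun i => w i ω) (fun i => t i ω) i)
        (w i ω) (t i ω)).Nonempty) :
    1 - δ / 2 ≤ μ.real {ω | AutoLabel.ErrorBound f (fun m => x m ω) (fun j => v j ω)
      (fun i => w i ω) (fun i => t i ω) k δ p₀} ∧
    1 - δ / 2 ≤ μ.real {ω | AutoLabel.CoverageBound (fun m => x m ω) (fun i => w i ω)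
      (fun i => t i ω) k δ} := by
  have hX : Measurable fun ω m => x m ω := measurable_pi_lambda _ hx
  have hV : Measurable fun ω j => v j ω := measurable_pi_lambda _ hv
  have hXlaw := AutoLabel.map_sample_eq_pi hx hxlaw hxind
  have hVlaw := AutoLabel.map_sample_eq_pi hv hvlaw hvind
  let θ (ω : Ω) : AutoLabel.RunParams d := (fun i => w i ω, fun i => t i ω)
  have hθ : Measurable θ := (measurable_pi_lambda _ hw).prodMk (measurable_pi_lambda _ ht)
  exact ⟨AutoLabel.one_sub_le_measure_errorBound (θ := θ) hd hN hk hδ hδ1 hp hp1 hf hX hXlaw hV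
      hVlaw hθ fun ω i hi => (hthreshold ω i hi).imp_right And.right,
    AutoLabel.one_sub_le_measure_coverageBound (θ := θ) hd hN hk hδ hδ1 hX hXlaw hθ hnorm
      fun ω i hi => (hthreshold ω i hi).imp_right And.left⟩

theorem mainTheorem3 {Ω : Type*} [MeasurableSpace Ω]
    (μ : MeasureTheory.Measure Ω) [MeasureTheory.IsProbabilityMeasure μ]
    (d N M k : ℕ) (hd : 1 ≤ d) (hN : d ≤ N) (hk : 1 ≤ k)
    (δ p₀ : ℝ) (hδ : 0 < δ) (hδ1 : δ < 1) (hp : 0 < p₀) (hp1 : p₀ < 1)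
    -- the true labeling (the realizable case is `f = linClassifier u`)
    (f : AutoLabel.E d → SignType) (hf : ∀ s, MeasurableSet (f ⁻¹' {s}))
    (par : AutoLabel.Params d) (hn₀ : 1 ≤ par.n₀)
    -- pool and validation sample: jointly i.i.d., uniform on the unit ball
    (x : Fin N → Ω → AutoLabel.E d) (v : Fin M → Ω → AutoLabel.E d)
    (hx : ∀ m, Measurable (x m)) (hv : ∀ j, Measurable (v j))
    (hxlaw : ∀ m, μ.map (x m) = AutoLabel.unifBall d)
    (hvlaw : ∀ j, μ.map (v j) = AutoLabel.unifBall d)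
    (hind : ProbabilityTheory.iIndepFun (Sum.elim x v) μ)
    -- `k` rounds of the algorithm
    (Q : ℕ → Ω → Finset (Fin N)) (w : ℕ → Ω → AutoLabel.E d) (t : ℕ → Ω → EReal)
    (hw : ∀ i, Measurable (w i)) (ht : ∀ i, Measurable (t i))
    (hrun : ∀ ω, AutoLabel.IsTBALRun par f (fun m => x m ω) (fun j => v j ω) k
      (fun i => Q i ω) (fun i => w i ω) (fun i => t i ω)) :
    -- auto-labeling error
    (1 - δ / 2 ≤ μ.real {ω |
      let X : Fin N → AutoLabel.E d := fun m => x m ω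
      let V : Fin M → AutoLabel.E d := fun j => v j ω
      let W : ℕ → AutoLabel.E d := fun i => w i ω
      let T : ℕ → EReal := fun i => t i ω
      let nv : ℕ → ℕ := fun i => (AutoLabel.remaining V W T i).card
      let na : ℕ → ℕ := fun i => (AutoLabel.autoRound X W T i).card
      let Na : ℕ := ∑ i ∈ Finset.range k, na i
      (∀ i < k, p₀ ≤ AutoLabel.acceptProb (W i) (T i) (AutoLabel.region W T i)) →
      (∀ i < k, d ≤ nv i) → d ≤ Na →
      AutoLabel.autoErr f X W T k ≤
        ∑ i ∈ Finset.range k, (na i : ℝ) / (Na : ℝ) *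
          (AutoLabel.empCondErr f V (AutoLabel.remaining V W T i) (W i) (T i)
            + 4 / p₀ * √(2 / (nv i : ℝ) * AutoLabel.complexityTerm d k δ (nv i)))
        + 4 / p₀ * √(2 * (k : ℝ) / (Na : ℝ) * AutoLabel.complexityTerm d k δ Na)}) ∧
    -- coverage
    (1 - δ / 2 ≤ μ.real {ω |
      (1 : EReal) - (⨅ i : Fin k, t i ω) * ((√(4 * (d : ℝ) / Real.pi) : ℝ) : EReal)
        - ((2 * (k : ℝ) * √(2 / (N : ℝ) * AutoLabel.complexityTerm d k δ N) : ℝ) : EReal)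
      ≤ ((AutoLabel.coverage (fun m => x m ω) (fun i => w i ω) (fun i => t i ω) k : ℝ) :
          EReal)}) := by
  have hxind : ProbabilityTheory.iIndepFun x μ := by simpa using hind.precomp Sum.inl_injective
  have hvind : ProbabilityTheory.iIndepFun v μ := by simpa using hind.precomp Sum.inr_injective
  exact mainTheorem3_general μ d N M k hd hN hk δ p₀ hδ hδ1 hp hp1 f hf x v hx hv hxlaw hvlaw
    hxind hvind w t hw ht (fun ω i hi => ((hrun ω).erm i hi).1)
    fun ω i hi => (hrun ω).threshold_eq_top_or hn₀ hi
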